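/- Let $(T_i^+)_{i\ge1}$ and $(T_i^-)_{i\ge1}$ be two mutually independent sequences of iid non-negative random variables with absolutely continuous distributions and finite means $\mu_+$ and $\mu_-$, and let $\delta$ be a random variable independent of both sequences that takes each of the values $1$ and $-1$ with positive probability. Let $D(t)$, $t\ge 0$, be the non-stationary switch process: $D(0)=\delta$, and $D$ changes sign at the end of each of the consecutive intervals of lengths $T_1^+,T_1^-,T_2^+,T_2^-,\dots$ if $\delta=1$, and of lengths $T_1^-,T_1^+,T_2^-,T_2^+,\dots$ if $\delta=-1$. Put $E_\pm(t)=\mathbb E[D(t)\mid\delta=\pm1]$, $\alpha=\mu_- /(\mu_++\mu_-)$ and $\beta=\mu_+/(\mu_++\mu_-)$. The functions $E_+$ and $E_-$ are differentiable at almost every $t>0$. Assume that $-E_+'(t)\ge0$ and $E_-'(t)\ge0$ at every $t>0$ at which the respective derivative exists. Then $$f_X(t)=-\frac{1}{2\alpha}E_+'(t),\qquad f_Y(t)=\frac{1}{2\beta}E_-'(t)$$ are probability densities on $(0,\infty)$, and $$T_1^-+T_1^+\ \stackrel{d}{=}\ \sum_{k=1}^{\nu_\beta}X_k+\sum_{k=1}^{\nu_\alpha}Y_k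 ,$$ where $\nu_\alpha$ and $\nu_\beta$ are independent geometric variables with $\mathbb P(\nu_p=k)=(1-p)^{k-1}p$, $k=1,2,\dots$, for $p=\alpha,\beta$, and $(X_k)$ and $(Y_k)$ are mutually independent sequences of iid random variables with densities $f_X$ and $f_Y$, independent of $(\nu_\alpha,\nu_\beta)$. For every $n\ge0$, the time from the $n$-th switch (the $0$-th being at time zero) to the $(n+2)$-nd switch, that is, the time from a switch until the process returns to that state, has this same distribution. -/

import Mathlib

open MeasureTheory ProbabilityTheory

noncomputable section

namespace SwitchProcess

variable {Ω : Type*}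

open Classical in
/-- Length of the `n`-th sojourn (`n = 0, 1, 2, …`) after time zero. If `δ = 1` the lengths are
`T⁺₀, T⁻₀, T⁺₁, T⁻₁, …`; if `δ = -1` they are `T⁻₀, T⁺₀, T⁻₁, T⁺₁, …`. -/
def sojourn (δ : Ω → ℝ) (Tp Tm : ℕ → Ω → ℝ) (n : ℕ) (ω : Ω) : ℝ :=
  if δ ω = 1 then (if Even n then Tp (n / 2) ω else Tm (n / 2) ω)
  else (if Even n then Tm (n / 2) ω else Tp (n / 2) ω)

/-- Time of the `n`-th switch; the `0`-th switch is placed at time zero. -/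
def switchTime (δ : Ω → ℝ) (Tp Tm : ℕ → Ω → ℝ) (n : ℕ) (ω : Ω) : ℝ :=
  ∑ i ∈ Finset.range n, sojourn δ Tp Tm i ω

/-- Number of switches in `(0, t]` (the switch at the origin is not counted). -/
def switchCount (δ : Ω → ℝ) (Tp Tm : ℕ → Ω → ℝ) (t : ℝ) (ω : Ω) : ℕ :=
  Set.ncard {n : ℕ | 1 ≤ n ∧ switchTime δ Tp Tm n ω ≤ t}

/-- The non-stationary switch process `D(t)`, `t ≥ 0`: it starts at `δ` and changes sign at every
switch. -/
def process (δ : Ω → ℝ) (Tp Tm : ℕ → Ω → ℝ) (t : ℝ) (ω : Ω) : ℝ :=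
  δ ω * (-1) ^ switchCount δ Tp Tm t ω

/-- The expected value function `t ↦ E[D(t) | δ = s]`, for `s = 1` (that is `E₊`) and `s = -1`
(that is `E₋`). -/
def expectedValue [MeasurableSpace Ω] (P : Measure Ω) (δ : Ω → ℝ) (Tp Tm : ℕ → Ω → ℝ)
    (s t : ℝ) : ℝ :=
  ∫ ω, process δ Tp Tm t ω ∂(ProbabilityTheory.cond P {ω | δ ω = s})

/-- The data of a non-stationary switch process: two mutually independent sequences of iid
switching times, independent of the starting state `δ`, which takes both values `1` and `-1` with
positive probability. The switching times are non-negative, absolutely continuous (hence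
without atom at zero) and have finite expectation. -/
structure IsSwitchData [MeasurableSpace Ω] (P : Measure Ω) (δ : Ω → ℝ) (Tp Tm : ℕ → Ω → ℝ) :
    Prop where
  measurable_delta : Measurable δ
  delta_eq : ∀ ω, δ ω = 1 ∨ δ ω = -1
  pos_plus : 0 < P {ω | δ ω = 1}
  pos_minus : 0 < P {ω | δ ω = -1}
  measurable_plus : ∀ i, Measurable (Tp i)
  measurable_minus : ∀ i, Measurable (Tm i)
  indep_times : iIndepFun (fun i : ℕ ⊕ ℕ => Sum.elim Tp Tm i) P
  indep_delta : IndepFun δ (fun ω => ((fun i => Tp i ω), (fun i => Tm i ω))) P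
  identDistrib_plus : ∀ i, IdentDistrib (Tp i) (Tp 0) P P
  identDistrib_minus : ∀ i, IdentDistrib (Tm i) (Tm 0) P P
  nonneg_plus : ∀ᵐ ω ∂P, 0 ≤ Tp 0 ω
  nonneg_minus : ∀ᵐ ω ∂P, 0 ≤ Tm 0 ω
  absolutelyContinuous_plus : P.map (Tp 0) ≪ volume
  absolutelyContinuous_minus : P.map (Tm 0) ≪ volume
  integrable_plus : Integrable (Tp 0) P
  integrable_minus : Integrable (Tm 0) P

/-- `ν` is geometric with parameter `p` on `{1, 2, …}`: `P(ν = k) = (1 - p) ^ (k - 1) * p`. -/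
def IsGeometric [MeasurableSpace Ω] (P : Measure Ω) (ν : Ω → ℕ) (p : ℝ) : Prop :=
  Measurable ν ∧ ∀ k : ℕ, P {ω | ν ω = k + 1} = ENNReal.ofReal ((1 - p) ^ k * p)

/-- `V` is a positive random variable with density `f` on `(0, ∞)`. -/
def HasDensity [MeasurableSpace Ω] (P : Measure Ω) (V : Ω → ℝ) (f : ℝ → ℝ) : Prop :=
  Measurable V ∧
    P.map V = (volume.restrict (Set.Ioi 0)).withDensity (fun t => ENNReal.ofReal (f t))

/-- Independent geometric variables `να`, `νβ` with parameters `α`, `β` and mutually independent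
iid sequences `X`, `Y` with densities `fX`, `fY`, the sequences being independent of the
geometric variables. -/
structure IsGeometricSumData [MeasurableSpace Ω] (P : Measure Ω) (α β : ℝ) (fX fY : ℝ → ℝ)
    (να νβ : Ω → ℕ) (X Y : ℕ → Ω → ℝ) : Prop where
  geometric_alpha : IsGeometric P να α
  geometric_beta : IsGeometric P νβ β
  density_X : ∀ k, HasDensity P (X k) fX
  density_Y : ∀ k, HasDensity P (Y k) fY
  indep_counts : IndepFun να νβ P
  indep_terms : iIndepFun (fun i : ℕ ⊕ ℕ => Sum.elim X Y i) P
  indep_counts_terms : IndepFun (fun ω => (να ω, νβ ω))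
    (fun ω => ((fun k => X k ω), (fun k => Y k ω))) P

/-- `∑_{k=1}^{νβ} X_k + ∑_{k=1}^{να} Y_k`, with the sequences indexed from zero. -/
def geometricSum (να νβ : Ω → ℕ) (X Y : ℕ → Ω → ℝ) (ω : Ω) : ℝ :=
  ∑ k ∈ Finset.range (νβ ω), X k ω + ∑ k ∈ Finset.range (να ω), Y k ω

end SwitchProcess

end

/-!
The proof computes Laplace transforms `laplace μ s = ∫⁻ exp (-s x) dμ` for real `s > 0`, with values
in `ℝ≥0∞`, so that no integrability has to be tracked. Write `A`, `B` for the transforms of the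
laws of the first and the second switching time of the process started in a given state.

Given the starting state, the switch times are the partial sums `S₁ < S₂ < …` of an alternating
sequence of independent variables. As the sign at time `t`, relative to the
starting state, is
`1 - 2 (#{k : S_{2k+1} ≤ t} - #{k : S_{2k+2} ≤ t})`, the expected sign is
`1 - 2 (M₁ (-∞, t] - M₂ (-∞, t])`, where `M₁`, `M₂` are the intensity measures of the odd and of
the even switches (`IsAlternatingRenewal.expectedSign_eq`). Their transforms are the geometric
series `A / (1 - A B)` and `A B / (1 - A B)`. Both measures are absolutely continuous and finite on
bounded-above half-lines, hence by the Lebesgue differentiation theorem the expected sign has almost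
everywhere the derivative `-2 (m₁ - m₂)`, in terms of the densities. The sign hypothesis says
`m₂ ≤ m₁`, so the measure `K` with density `-E' / 2` satisfies `M₁ = K + M₂`
(`IsAlternatingRenewal.switchMeasure_one_eq_add`) and has the transform `A (1 - B) / (1 - A B)`.
Letting `s → 0`, where `(1 - A) / s` and `(1 - B) / s` tend to the means, gives the total mass of
`K` (`IsAlternatingRenewal.decreaseMeasure_univ`), which is `α` for the start in `1` and `β` for
the start in `-1`. Thus `f_X` and `f_Y` are the densities of `K / α` and `K / β` for the two starts.

A geometric sum with parameter `p` of variables with transform `x` has the transform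
`p x / (1 - (1 - p) x)`. With `a`, `b` the transforms of `T⁺`, `T⁻`, the product of the transforms
of the two geometric sums telescopes to `a b` (`geometric_laplace_identity`), the transform of
`T⁻ + T⁺`. Laplace transforms determine probability laws on `[0, ∞)` (`eq_of_laplace_eq`), by
Stone–Weierstrass. Finally any two consecutive sojourns consist of one `T⁺` and one `T⁻`,
whichever the independent starting state is.
-/

noncomputable section

namespace SwitchProcess

open Filter Topology Set
open scoped ENNReal NNReal

/-! ### Laplace transforms of measures on the line -/

/-- The Laplace transform `s ↦ ∫ exp (-s x) dμ` of a measure on the line, as a lower integral with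
values in `ℝ≥0∞`. It is used for `s ≥ 0` and measures carried by `[0, ∞)`. -/
def laplace (μ : Measure ℝ) (s : ℝ) : ℝ≥0∞ :=
  ∫⁻ x, ENNReal.ofReal (Real.exp (-(s * x))) ∂μ

lemma measurable_laplaceKernel (s : ℝ) :
    Measurable fun x : ℝ => ENNReal.ofReal (Real.exp (-(s * x))) := by
  fun_prop

lemma laplace_map {Ω : Type*} [MeasurableSpace Ω] {P : Measure Ω} {X : Ω → ℝ}
    (hX : AEMeasurable X P) (s : ℝ) :
    laplace (P.map X) s = ∫⁻ ω, ENNReal.ofReal (Real.exp (-(s * X ω))) ∂P := by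
  rw [laplace, lintegral_map' (measurable_laplaceKernel s).aemeasurable hX]

lemma laplace_sum {ι : Type*} (μ : ι → Measure ℝ) (s : ℝ) :
    laplace (Measure.sum μ) s = ∑' i, laplace (μ i) s :=
  lintegral_sum_measure _ _

lemma laplace_add (μ ν : Measure ℝ) (s : ℝ) :
    laplace (μ + ν) s = laplace μ s + laplace ν s :=
  lintegral_add_measure _ _ _

lemma laplace_smul (c : ℝ≥0∞) (μ : Measure ℝ) (s : ℝ) :
    laplace (c • μ) s = c * laplace μ s :=
  lintegral_smul_measure _ _

/-- The transform is multiplicative on sums of independent variables. -/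
lemma laplace_map_finsetSum {Ω ι : Type*} [MeasurableSpace Ω] {P : Measure Ω} {X : ι → Ω → ℝ}
    (hX : ∀ i, Measurable (X i)) (hind : iIndepFun X P) (I : Finset ι) (s : ℝ) :
    laplace (P.map fun ω => ∑ i ∈ I, X i ω) s = ∏ i ∈ I, laplace (P.map (X i)) s := by
  rw [laplace_map (Finset.measurable_fun_sum I fun i _ => hX i).aemeasurable]
  have h := lintegral_prod_eq_prod_lintegral_of_indepFun I
    (fun i ω => ENNReal.ofReal (Real.exp (-(s * X i ω))))
    (hind.comp (fun _ x => ENNReal.ofReal (Real.exp (-(s * x))))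
      fun _ => measurable_laplaceKernel s) (fun i => (measurable_laplaceKernel s).comp (hX i))
  simp_rw [laplace_map (hX _).aemeasurable]
  rw [← h]
  refine lintegral_congr fun ω => ?_
  rw [← ENNReal.ofReal_prod_of_nonneg fun i _ => (Real.exp_pos _).le, ← Real.exp_sum,
    Finset.sum_neg_distrib, Finset.mul_sum]

lemma laplace_le_measure_univ {μ : Measure ℝ} (hμ : ∀ᵐ x ∂μ, 0 ≤ x) {s : ℝ} (hs : 0 ≤ s) :
    laplace μ s ≤ μ univ := by
  rw [← lintegral_one]
  refine lintegral_mono_ae ?_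
  filter_upwards [hμ] with x hx
  rw [← ENNReal.ofReal_one]
  exact ENNReal.ofReal_le_ofReal (Real.exp_le_one_iff.2 (by nlinarith))

lemma laplace_lt_one {μ : Measure ℝ} [IsProbabilityMeasure μ] (hμ : ∀ᵐ x ∂μ, 0 < x) {s : ℝ}
    (hs : 0 < s) : laplace μ s < 1 := by
  have h1 : ∫⁻ _x : ℝ, (1 : ℝ≥0∞) ∂μ = 1 := by simp
  have hle := laplace_le_measure_univ (hμ.mono fun x hx => hx.le) hs.le
  rw [laplace, ← h1]
  refine lintegral_strict_mono (IsProbabilityMeasure.ne_zero μ) (by fun_prop) ?_ ?_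
  · exact (hle.trans_lt (measure_lt_top _ _)).ne
  · filter_upwards [hμ] with x hx
    rw [← ENNReal.ofReal_one]
    exact (ENNReal.ofReal_lt_ofReal_iff one_pos).2 (by rw [Real.exp_lt_one_iff]; nlinarith)

lemma laplace_pos {μ : Measure ℝ} [NeZero μ] (s : ℝ) : 0 < laplace μ s := by
  rw [laplace, lintegral_pos_iff_support (measurable_laplaceKernel s)]
  have : Function.support (fun x : ℝ => ENNReal.ofReal (Real.exp (-(s * x)))) = univ := by
    ext x; simp [Real.exp_pos]
  rw [this]
  exact Measure.measure_univ_pos.2 (NeZero.ne μ)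

/-- Markov's inequality for `exp (-s x)`. -/
lemma measure_Iic_le_laplace (μ : Measure ℝ) (t : ℝ) {s : ℝ} (hs : 0 ≤ s) :
    μ (Iic t) ≤ ENNReal.ofReal (Real.exp (s * t)) * laplace μ s := by
  rw [laplace, ← lintegral_const_mul _ (measurable_laplaceKernel s),
    ← lintegral_indicator_one measurableSet_Iic]
  refine lintegral_mono fun x => ?_
  by_cases hx : x ≤ t
  · rw [indicator_of_mem (by exact hx), ← ENNReal.ofReal_mul (Real.exp_pos _).le, ← Real.exp_add,
      Pi.one_apply, ← ENNReal.ofReal_one]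
    exact ENNReal.ofReal_le_ofReal (Real.one_le_exp (by nlinarith))
  · rw [indicator_of_notMem (by exact hx)]
    exact zero_le

lemma tendsto_laplace_measure_univ {μ : Measure ℝ} (hμ : ∀ᵐ x ∂μ, 0 ≤ x) :
    Tendsto (fun n : ℕ => laplace μ (1 / ((n : ℝ) + 1))) atTop (𝓝 (μ univ)) := by
  rw [← lintegral_one]
  refine lintegral_tendsto_of_tendsto_of_monotone
    (fun n => (measurable_laplaceKernel _).aemeasurable) ?_ ?_
  · filter_upwards [hμ] with x hx n m hnm
    refine ENNReal.ofReal_le_ofReal (Real.exp_le_exp.2 (neg_le_neg ?_))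
    exact mul_le_mul_of_nonneg_right (one_div_le_one_div_of_le (by positivity)
      (by exact_mod_cast Nat.succ_le_succ hnm)) hx
  · refine Eventually.of_forall fun x => ?_
    rw [← ENNReal.ofReal_one]
    refine ENNReal.tendsto_ofReal ?_
    have : Tendsto (fun n : ℕ => Real.exp (-(1 / ((n : ℝ) + 1) * x))) atTop
        (𝓝 (Real.exp (-(0 * x)))) :=
      (Real.continuous_exp.tendsto _).comp
        ((tendsto_one_div_add_atTop_nhds_zero_nat (𝕜 := ℝ)).mul_const x).neg
    simpa using this

lemma toReal_laplace (μ : Measure ℝ) (s : ℝ) :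
    (laplace μ s).toReal = ∫ x, Real.exp (-(s * x)) ∂μ := by
  rw [laplace, integral_eq_lintegral_of_nonneg_ae
    (Eventually.of_forall fun x => (Real.exp_pos _).le) (by fun_prop)]

/-- Minus the derivative of the transform at `0` is the mean; along the sequence `s = 1 / (n + 1)`
this is dominated convergence with `1 - exp (-s x) ≤ s x`. -/
lemma tendsto_one_sub_laplace_div {μ : Measure ℝ} [IsProbabilityMeasure μ]
    (hμ : ∀ᵐ x ∂μ, 0 ≤ x) (hint : Integrable (fun x => x) μ) :
    Tendsto (fun n : ℕ => (1 - (laplace μ (1 / ((n : ℝ) + 1))).toReal) * ((n : ℝ) + 1)) atTop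
      (𝓝 (∫ x, x ∂μ)) := by
  have hI (n : ℕ) : Integrable (fun x => Real.exp (-(1 / ((n : ℝ) + 1) * x))) μ := by
    refine Integrable.of_bound (by fun_prop) 1 ?_
    filter_upwards [hμ] with x hx
    rw [Real.norm_of_nonneg (Real.exp_pos _).le]
    exact Real.exp_le_one_iff.2 (by have : 0 ≤ 1 / ((n : ℝ) + 1) * x := by positivity
                                    linarith)
  have hrw (n : ℕ) : (1 - (laplace μ (1 / ((n : ℝ) + 1))).toReal) * ((n : ℝ) + 1) =
      ∫ x, (1 - Real.exp (-(1 / ((n : ℝ) + 1) * x))) * ((n : ℝ) + 1) ∂μ := by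
    rw [integral_mul_const, integral_sub (integrable_const _) (hI n), toReal_laplace]
    simp
  simp_rw [hrw]
  refine tendsto_integral_of_dominated_convergence (fun x => x)
    (fun n => by fun_prop) hint (fun n => ?_) ?_
  · filter_upwards [hμ] with x hx
    have hn : (0 : ℝ) < (n : ℝ) + 1 := by positivity
    have h0 : 0 ≤ 1 / ((n : ℝ) + 1) * x := by positivity
    have h1 := Real.add_one_le_exp (-(1 / ((n : ℝ) + 1) * x))
    have h2 := Real.exp_le_one_iff.2 (neg_nonpos.2 h0)
    rw [Real.norm_of_nonneg (mul_nonneg (by linarith) hn.le)]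
    calc (1 - Real.exp (-(1 / ((n : ℝ) + 1) * x))) * ((n : ℝ) + 1)
        ≤ (1 / ((n : ℝ) + 1) * x) * ((n : ℝ) + 1) :=
          mul_le_mul_of_nonneg_right (by linarith) hn.le
      _ = x := by field_simp
  · refine Eventually.of_forall fun x => ?_
    have hd : HasDerivAt (fun s : ℝ => Real.exp (-(s * x))) (-x) 0 := by
      have := (((hasDerivAt_id (0 : ℝ)).mul_const x).neg).exp
      simpa using this
    have h0 := hd.tendsto_slope
    have hseq : Tendsto (fun n : ℕ => 1 / ((n : ℝ) + 1)) atTop (𝓝[≠] 0) :=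
      tendsto_nhdsWithin_iff.2 ⟨tendsto_one_div_add_atTop_nhds_zero_nat,
        Eventually.of_forall fun n => by simp; positivity⟩
    have h2 := (h0.comp hseq).neg
    rw [neg_neg] at h2
    refine h2.congr fun n => ?_
    have hn : (n : ℝ) + 1 ≠ 0 := by positivity
    simp only [Function.comp, slope_def_field]
    field_simp
    simp

/-- The Laplace transform determines a probability law on `[0, ∞)`: the integer values of `s` give
the integrals of all polynomials in `exp (-x)`, an algebra that separates the points of `[0, ∞)`. -/
theorem eq_of_laplace_eq {μ ν : Measure ℝ} [IsProbabilityMeasure μ] [IsProbabilityMeasure ν]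
    (hμ : ∀ᵐ x ∂μ, 0 ≤ x) (hν : ∀ᵐ x ∂ν, 0 ≤ x)
    (h : ∀ s : ℝ, 0 < s → laplace μ s = laplace ν s) : μ = ν := by
  have hback {ρ : Measure ℝ} (hρ : ∀ᵐ x ∂ρ, 0 ≤ x) :
      (ρ.map Real.toNNReal).map ((↑) : ℝ≥0 → ℝ) = ρ := by
    rw [Measure.map_map measurable_coe_nnreal_real measurable_real_toNNReal]
    conv_rhs => rw [← Measure.map_id (μ := ρ)]
    refine Measure.map_congr ?_
    filter_upwards [hρ] with x hx
    simp [Real.coe_toNNReal x hx]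
  rw [← hback hμ, ← hback hν]
  congr 1
  have hpm (ρ : Measure ℝ) [IsProbabilityMeasure ρ] :
      IsProbabilityMeasure (ρ.map Real.toNNReal) :=
    Measure.isProbabilityMeasure_map measurable_real_toNNReal.aemeasurable
  have := hpm μ
  have := hpm ν
  -- `e x = exp (-x)` generates the separating algebra
  let e : BoundedContinuousFunction ℝ≥0 ℝ := BoundedContinuousFunction.ofNormedAddCommGroup
    (fun x : ℝ≥0 => Real.exp (-(x : ℝ))) (by fun_prop) 1 (fun x => by
      rw [Real.norm_of_nonneg (Real.exp_pos _).le]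
      exact Real.exp_le_one_iff.2 (by simp))
  have hpow (ρ : Measure ℝ) [IsProbabilityMeasure ρ] (hρ : ∀ᵐ x ∂ρ, 0 ≤ x) (n : ℕ) :
      ∫ x, (e ^ n : BoundedContinuousFunction ℝ≥0 ℝ) x ∂(ρ.map Real.toNNReal) =
        (laplace ρ n).toReal := by
    rw [integral_map measurable_real_toNNReal.aemeasurable
      (BoundedContinuousFunction.continuous _).aestronglyMeasurable, toReal_laplace]
    refine integral_congr_ae ?_
    filter_upwards [hρ] with x hx
    simp [e, ← Real.exp_nat_mul, Real.coe_toNNReal x hx]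
  let A : StarSubalgebra ℝ (BoundedContinuousFunction ℝ≥0 ℝ) :=
    { Algebra.adjoin ℝ {e} with
      star_mem' := fun {a} ha => by
        have : star a = a := by ext x; simp
        rw [this]; exact ha }
  refine ext_of_forall_mem_subalgebra_integral_eq_of_polish (𝕜 := ℝ) (A := A) ?_ ?_
  · intro x y hxy
    refine ⟨e, ⟨_, ⟨e, Algebra.subset_adjoin rfl, rfl⟩, rfl⟩, ?_⟩
    intro hc
    apply hxy
    have : Real.exp (-(x : ℝ)) = Real.exp (-(y : ℝ)) := hc
    rw [Real.exp_eq_exp, neg_inj] at this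
    exact_mod_cast this
  · intro g hg
    have hg' : g ∈ Algebra.adjoin ℝ {e} := hg
    rw [Algebra.adjoin_singleton_eq_range_aeval] at hg'
    obtain ⟨p, rfl⟩ := hg'
    induction p using Polynomial.induction_on' with
    | add p q hp hq =>
      have hi (ρ : Measure ℝ≥0) [IsProbabilityMeasure ρ] (f : BoundedContinuousFunction ℝ≥0 ℝ) :
        Integrable (fun x => f x) ρ := BoundedContinuousFunction.integrable ρ f
      have mem (r : Polynomial ℝ) : Polynomial.aeval e r ∈ A := by
        change Polynomial.aeval e r ∈ Algebra.adjoin ℝ {e}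
        rw [Algebra.adjoin_singleton_eq_range_aeval]
        exact ⟨r, rfl⟩
      have hp := hp (mem p)
      have hq := hq (mem q)
      simp only [AlgHom.toRingHom_eq_coe, RingHom.coe_coe] at hp hq ⊢
      simp only [map_add, BoundedContinuousFunction.coe_add, Pi.add_apply]
      rw [integral_add (hi _ _) (hi _ _), integral_add (hi _ _) (hi _ _), hp, hq]
    | monomial n a =>
      simp only [AlgHom.toRingHom_eq_coe, RingHom.coe_coe, Polynomial.aeval_monomial,
        ← Algebra.smul_def, BoundedContinuousFunction.coe_smul, smul_eq_mul]
      rw [integral_const_mul, integral_const_mul, hpow μ hμ, hpow ν hν]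
      rcases Nat.eq_zero_or_pos n with rfl | hn
      · simp [laplace]
      · rw [h n (by exact_mod_cast hn)]

/-! ### Alternating renewal sequences and the expected sign -/

/-- The `n`-th partial sum `τ₀ + ⋯ + τₙ₋₁`. -/
def partialSum {Ω : Type*} (τ : ℕ → Ω → ℝ) (n : ℕ) (ω : Ω) : ℝ :=
  ∑ i ∈ Finset.range n, τ i ω

/-- `τ` is a sequence of independent variables with law `a` at even and `b` at odd indices, both
laws being absolutely continuous and carried by `(0, ∞)`. -/
structure IsAlternatingRenewal {Ω : Type*} [MeasurableSpace Ω] (P : Measure Ω) (τ : ℕ → Ω → ℝ)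
    (a b : Measure ℝ) : Prop where
  measurable : ∀ n, Measurable (τ n)
  indep : iIndepFun τ P
  law : ∀ n, P.map (τ n) = if Even n then a else b
  ac_even : a ≪ volume
  ac_odd : b ≪ volume
  pos_even : ∀ᵐ x ∂a, 0 < x
  pos_odd : ∀ᵐ x ∂b, 0 < x

/-- The measure `∑ₖ law (S_{2k+r})`, where `S` are the partial sums of `τ`. For `r = 1` and `r = 2`
it is the intensity of the odd-numbered and of the even-numbered switches. -/
def switchMeasure {Ω : Type*} [MeasurableSpace Ω] (P : Measure Ω) (τ : ℕ → Ω → ℝ) (r : ℕ) :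
    Measure ℝ :=
  Measure.sum fun k => P.map (partialSum τ (2 * k + r))

/-- The expectation of `(-1) ^ N(t)`, where `N(t)` is the number of partial sums `Sₙ`, `n ≥ 1`, in
`(-∞, t]`. -/
def expectedSign {Ω : Type*} [MeasurableSpace Ω] (P : Measure Ω) (τ : ℕ → Ω → ℝ) (t : ℝ) : ℝ :=
  ∫ ω, (-1 : ℝ) ^ Set.ncard {n : ℕ | 1 ≤ n ∧ partialSum τ n ω ≤ t} ∂P

/-- A monotone sequence that passes `t` has exactly an initial segment of its terms `u 1, u 2, …`
in `(-∞, t]`. The index `N` may be `0`. -/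
lemma exists_forall_le_iff {u : ℕ → ℝ} (hu : Monotone u) {t : ℝ} (ht : ∃ n, t < u n) :
    ∃ N : ℕ, ∀ n, 1 ≤ n → (u n ≤ t ↔ n ≤ N) := by
  classical
  have h : ∃ n, t < u (n + 1) := by
    obtain ⟨n, hn⟩ := ht
    exact ⟨n, hn.trans_le (hu n.le_succ)⟩
  refine ⟨Nat.find h, fun n hn => ⟨fun hle => ?_, fun hle => ?_⟩⟩
  · by_contra hc
    exact absurd ((Nat.find_spec h).trans_le (hu (by omega : Nat.find h + 1 ≤ n))) (not_lt.2 hle)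
  · have := Nat.find_min h (m := n - 1) (by omega)
    rwa [Nat.sub_add_cancel hn, not_lt] at this

/-- The number of indices `≤ N` among `r, r + 2, r + 4, …`. For `r > N + 2` both sides vanish by
truncated subtraction. -/
lemma tsum_indicator_le {u : ℕ → ℝ} {t : ℝ} {N r : ℕ} (hr : 1 ≤ r)
    (hN : ∀ n, 1 ≤ n → (u n ≤ t ↔ n ≤ N)) :
    ∑' k : ℕ, (Iic t).indicator (1 : ℝ → ℝ≥0∞) (u (2 * k + r)) = ((N + 2 - r) / 2 : ℕ) := by
  have h (k : ℕ) : (Iic t).indicator (1 : ℝ → ℝ≥0∞) (u (2 * k + r)) =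
      if k ∈ Finset.range ((N + 2 - r) / 2) then 1 else 0 := by
    have : 2 * k + r ≤ N ↔ k < (N + 2 - r) / 2 := by omega
    simp only [indicator_apply, mem_Iic, hN (2 * k + r) (by omega), Finset.mem_range, this,
      Pi.one_apply]
  simp_rw [h]
  rw [tsum_eq_sum (s := Finset.range ((N + 2 - r) / 2)) fun k hk => if_neg hk,
    Finset.sum_congr rfl fun k hk => if_pos hk]
  simp

/-- `(-1) ^ N` in terms of the numbers `⌈N / 2⌉` and `⌊N / 2⌋` of odd and even indices up to `N`,
these being written as sums of indicators. -/
lemma neg_one_pow_ncard {u : ℕ → ℝ} {t : ℝ} {N : ℕ} (hN : ∀ n, 1 ≤ n → (u n ≤ t ↔ n ≤ N)) :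
    (-1 : ℝ) ^ Set.ncard {n : ℕ | 1 ≤ n ∧ u n ≤ t} =
      1 - 2 * ((∑' k : ℕ, (Iic t).indicator (1 : ℝ → ℝ≥0∞) (u (2 * k + 1))).toReal -
        (∑' k : ℕ, (Iic t).indicator (1 : ℝ → ℝ≥0∞) (u (2 * k + 2))).toReal) := by
  rw [tsum_indicator_le le_rfl hN, tsum_indicator_le one_le_two hN]
  have : {n : ℕ | 1 ≤ n ∧ u n ≤ t} = ↑(Finset.Icc 1 N) := by
    ext n
    simp only [mem_ofPred_eq, Finset.coe_Icc, mem_Icc]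
    exact and_congr_right fun h => hN n h
  rw [this, Set.ncard_coe_finset, Nat.card_Icc, Nat.add_sub_cancel]
  simp only [ENNReal.toReal_natCast]
  rcases Nat.even_or_odd' N with ⟨m, rfl | rfl⟩
  · have h1 : (2 * m + 2 - 1) / 2 = m := by omega
    have h2 : (2 * m + 2 - 2) / 2 = m := by omega
    rw [h1, h2]; simp
  · have h1 : (2 * m + 1 + 2 - 1) / 2 = m + 1 := by omega
    have h2 : (2 * m + 1 + 2 - 2) / 2 = m := by omega
    rw [h1, h2, pow_succ]
    push_cast
    simp; norm_num

namespace IsAlternatingRenewal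

variable {Ω : Type*} [MeasurableSpace Ω] {P : Measure Ω}
  {τ : ℕ → Ω → ℝ} {a b : Measure ℝ}

lemma measurable_partialSum (h : IsAlternatingRenewal P τ a b) (n : ℕ) :
    Measurable (partialSum τ n) :=
  Finset.measurable_fun_sum _ fun i _ => h.measurable i

lemma ae_pos (h : IsAlternatingRenewal P τ a b) : ∀ᵐ ω ∂P, ∀ n, 0 < τ n ω := by
  refine ae_all_iff.2 fun n => ?_
  refine ae_of_ae_map (h.measurable n).aemeasurable (p := fun x => 0 < x) ?_
  rw [h.law n]
  split_ifs
  exacts [h.pos_even, h.pos_odd]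

lemma ae_monotone (h : IsAlternatingRenewal P τ a b) :
    ∀ᵐ ω ∂P, Monotone fun n => partialSum τ n ω := by
  filter_upwards [h.ae_pos] with ω hω
  refine monotone_nat_of_le_succ fun n => ?_
  simp only [partialSum, Finset.sum_range_succ]
  linarith [hω n]

lemma laplace_partialSum (h : IsAlternatingRenewal P τ a b) (n : ℕ) (s : ℝ) :
    laplace (P.map (partialSum τ n)) s =
      ∏ i ∈ Finset.range n, if Even i then laplace a s else laplace b s := by
  have := laplace_map_finsetSum h.measurable h.indep (Finset.range n) s
  rw [show partialSum τ n = fun ω => ∑ i ∈ Finset.range n, τ i ω from rfl, this]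
  refine Finset.prod_congr rfl fun i _ => ?_
  rw [h.law i]
  split_ifs <;> rfl

lemma laplace_partialSum_two_mul_add (h : IsAlternatingRenewal P τ a b) (k r : ℕ) (s : ℝ) :
    laplace (P.map (partialSum τ (2 * k + r))) s =
      (laplace a s * laplace b s) ^ k * laplace (P.map (partialSum τ r)) s := by
  simp only [h.laplace_partialSum]
  induction k with
  | zero => simp
  | succ k ih =>
    rw [show 2 * (k + 1) + r = 2 * k + r + 1 + 1 by ring, Finset.prod_range_succ,
      Finset.prod_range_succ, ih, pow_succ]
    rcases Nat.even_or_odd (2 * k + r) with he | ho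
    · have h1 : ¬ Even (2 * k + r + 1) := by simp [Nat.even_add_one, he]
      rw [if_pos he, if_neg h1]; ring
    · have h0 : ¬ Even (2 * k + r) := Nat.not_even_iff_odd.2 ho
      have h1 : Even (2 * k + r + 1) := by simp [Nat.even_add_one, h0]
      rw [if_neg h0, if_pos h1]; ring

/-- The transforms of `S_r, S_{r+2}, S_{r+4}, …` form a geometric series. -/
lemma laplace_switchMeasure (h : IsAlternatingRenewal P τ a b) (r : ℕ) (s : ℝ) :
    laplace (switchMeasure P τ r) s =
      laplace (P.map (partialSum τ r)) s * (1 - laplace a s * laplace b s)⁻¹ := by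
  rw [switchMeasure, laplace_sum]
  simp_rw [h.laplace_partialSum_two_mul_add]
  rw [ENNReal.tsum_mul_right, ENNReal.tsum_geometric, mul_comm]

lemma isProbabilityMeasure_even (h : IsAlternatingRenewal P τ a b) : IsProbabilityMeasure a := by
  have := h.indep.isProbabilityMeasure
  have := h.law 0
  simp only [Even.zero, if_true] at this
  exact this ▸ Measure.isProbabilityMeasure_map (h.measurable 0).aemeasurable

lemma isProbabilityMeasure_odd (h : IsAlternatingRenewal P τ a b) : IsProbabilityMeasure b := by
  have := h.indep.isProbabilityMeasure
  have := h.law 1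
  simp only [Nat.not_even_one, if_false] at this
  exact this ▸ Measure.isProbabilityMeasure_map (h.measurable 1).aemeasurable

lemma laplace_mul_lt_one (h : IsAlternatingRenewal P τ a b) {s : ℝ} (hs : 0 < s) :
    laplace a s * laplace b s < 1 := by
  have := h.isProbabilityMeasure_even
  have := h.isProbabilityMeasure_odd
  exact (mul_le_of_le_one_right' (laplace_lt_one h.pos_odd hs).le).trans_lt
    (laplace_lt_one h.pos_even hs)

lemma laplace_switchMeasure_lt_top (h : IsAlternatingRenewal P τ a b) (r : ℕ) {s : ℝ}
    (hs : 0 < s) : laplace (switchMeasure P τ r) s < ∞ := by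
  have := h.indep.isProbabilityMeasure
  rw [h.laplace_switchMeasure]
  refine ENNReal.mul_lt_top ?_ ?_
  · have : IsProbabilityMeasure (P.map (partialSum τ r)) :=
      Measure.isProbabilityMeasure_map (h.measurable_partialSum r).aemeasurable
    refine (laplace_le_measure_univ ?_ hs.le).trans_lt (measure_lt_top _ _)
    refine (ae_map_iff (h.measurable_partialSum r).aemeasurable measurableSet_Ici).2 ?_
    filter_upwards [h.ae_pos] with ω hω
    exact Finset.sum_nonneg fun i _ => (hω i).le
  · exact ENNReal.inv_lt_top.2 (tsub_pos_of_lt (h.laplace_mul_lt_one hs))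

/-- This includes the finiteness of the expected number of switches up to time `t`. -/
lemma switchMeasure_Iic_lt_top (h : IsAlternatingRenewal P τ a b) (r : ℕ) (t : ℝ) :
    switchMeasure P τ r (Iic t) < ∞ :=
  (measure_Iic_le_laplace _ t zero_le_one).trans_lt
    (ENNReal.mul_lt_top ENNReal.ofReal_lt_top (h.laplace_switchMeasure_lt_top r one_pos))

lemma switchMeasure_Iic_zero (h : IsAlternatingRenewal P τ a b) {r : ℕ} (hr : 1 ≤ r) :
    switchMeasure P τ r (Iic 0) = 0 := by
  rw [switchMeasure, Measure.sum_apply _ measurableSet_Iic, ENNReal.tsum_eq_zero]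
  intro k
  rw [Measure.map_apply (h.measurable_partialSum _) measurableSet_Iic]
  refine measure_eq_zero_iff_ae_notMem.2 ?_
  filter_upwards [h.ae_pos] with ω hω
  simp only [mem_preimage, mem_Iic, not_le]
  exact Finset.sum_pos (fun i _ => hω i) (by simp; omega)

lemma switchMeasure_absolutelyContinuous (h : IsAlternatingRenewal P τ a b) {r : ℕ}
    (hr : 1 ≤ r) : switchMeasure P τ r ≪ volume := by
  have := h.indep.isProbabilityMeasure
  refine Measure.absolutelyContinuous_sum_left fun k => ?_
  -- the last summand alone makes the law of the sum absolutely continuous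
  obtain ⟨n, hn⟩ : ∃ n, 2 * k + r = n + 1 := ⟨2 * k + r - 1, by omega⟩
  rw [hn]
  have hsum : partialSum τ (n + 1) = partialSum τ n + τ n := by
    ext ω; simp [partialSum, Finset.sum_range_succ]
  have hind : IndepFun (partialSum τ n) (τ n) P := by
    have := h.indep.indepFun_finsetSum_of_notMem h.measurable (s := Finset.range n) (i := n)
      (by simp)
    convert this using 1
    ext ω; simp [partialSum]
  rw [hsum, hind.map_add_eq_map_conv_map₀ (h.measurable_partialSum n).aemeasurable
    (h.measurable n).aemeasurable]
  refine Measure.conv_absolutelyContinuous ?_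
  rw [h.law n]
  split_ifs
  exacts [h.ac_even, h.ac_odd]

lemma lintegral_tsum_indicator (h : IsAlternatingRenewal P τ a b) (r : ℕ) (t : ℝ) :
    ∫⁻ ω, ∑' k : ℕ, (Iic t).indicator (1 : ℝ → ℝ≥0∞) (partialSum τ (2 * k + r) ω) ∂P =
      switchMeasure P τ r (Iic t) := by
  have hm : Measurable ((Iic t).indicator (1 : ℝ → ℝ≥0∞)) :=
    measurable_one.indicator measurableSet_Iic
  rw [lintegral_tsum (f := fun k ω => (Iic t).indicator (1 : ℝ → ℝ≥0∞)
    (partialSum τ (2 * k + r) ω)) fun k => (hm.comp (h.measurable_partialSum _)).aemeasurable,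
    switchMeasure, Measure.sum_apply _ measurableSet_Iic]
  refine tsum_congr fun k => ?_
  rw [← lintegral_indicator_one measurableSet_Iic, lintegral_map hm (h.measurable_partialSum _)]

lemma expectedSign_eq (h : IsAlternatingRenewal P τ a b) (t : ℝ) :
    expectedSign P τ t =
      1 - 2 * ((switchMeasure P τ 1 (Iic t)).toReal - (switchMeasure P τ 2 (Iic t)).toReal) := by
  have := h.indep.isProbabilityMeasure
  let F (r : ℕ) (ω : Ω) : ℝ≥0∞ :=
    ∑' k : ℕ, (Iic t).indicator (1 : ℝ → ℝ≥0∞) (partialSum τ (2 * k + r) ω)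
  have hm : Measurable ((Iic t).indicator (1 : ℝ → ℝ≥0∞)) :=
    measurable_one.indicator measurableSet_Iic
  have hF (r : ℕ) : Measurable (F r) :=
    Measurable.tsum fun k => hm.comp (h.measurable_partialSum _)
  have hint (r : ℕ) : ∫⁻ ω, F r ω ∂P = switchMeasure P τ r (Iic t) :=
    h.lintegral_tsum_indicator r t
  have hfin (r : ℕ) : ∫⁻ ω, F r ω ∂P ≠ ∞ := by
    rw [hint]; exact (h.switchMeasure_Iic_lt_top r t).ne
  have hlt (r : ℕ) : ∀ᵐ ω ∂P, F r ω < ∞ := ae_lt_top (hF r) (hfin r)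
  have hI (r : ℕ) : Integrable (fun ω => (F r ω).toReal) P :=
    integrable_toReal_of_lintegral_ne_top (hF r).aemeasurable (hfin r)
  have hae : (fun ω => (-1 : ℝ) ^ Set.ncard {n : ℕ | 1 ≤ n ∧ partialSum τ n ω ≤ t}) =ᵐ[P]
      fun ω => 1 - 2 * ((F 1 ω).toReal - (F 2 ω).toReal) := by
    filter_upwards [h.ae_monotone, hlt 1] with ω hmono hω
    -- otherwise `F 1 ω` would be a sum of infinitely many ones
    have hex : ∃ n, t < partialSum τ n ω := by
      by_contra! hc
      have : F 1 ω = ∑' _ : ℕ, (1 : ℝ≥0∞) :=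
        tsum_congr fun k => indicator_of_mem (by exact hc _) _
      rw [this, ENNReal.tsum_const_eq_top_of_ne_zero one_ne_zero] at hω
      exact lt_irrefl _ hω
    obtain ⟨N, hN⟩ := exists_forall_le_iff hmono hex
    exact neg_one_pow_ncard hN
  have hr (r : ℕ) : ∫ ω, (F r ω).toReal ∂P = (switchMeasure P τ r (Iic t)).toReal := by
    rw [integral_toReal (hF r).aemeasurable (hlt r), hint]
  have hI' : Integrable (fun ω => 2 * ((F 1 ω).toReal - (F 2 ω).toReal)) P :=
    ((hI 1).sub (hI 2)).const_mul 2
  rw [expectedSign, integral_congr_ae hae, integral_sub (integrable_const _) hI',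
    integral_const_mul, integral_sub (hI 1) (hI 2), hr, hr]
  simp

end IsAlternatingRenewal

/-! ### The measure of decrease of the expected sign -/

/-- Lebesgue differentiation of the distribution function of an absolutely continuous measure on
`(0, ∞)` that need not be finite. -/
lemma ae_hasDerivAt_measure_Iic {M : Measure ℝ} [SFinite M] (hac : M ≪ volume)
    (hfin : ∀ t, M (Iic t) < ∞) (h0 : M (Iic 0) = 0) :
    ∀ᵐ t ∂(volume.restrict (Ioi 0)),
      HasDerivAt (fun u => (M (Iic u)).toReal) (M.rnDeriv volume t).toReal t := by
  set f := M.rnDeriv volume with hf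
  have hfm : Measurable f := Measure.measurable_rnDeriv _ _
  have hset (s : Set ℝ) : ∫⁻ x in s, f x = M s := Measure.setLIntegral_rnDeriv hac s
  have hint (t : ℝ) : IntegrableOn (fun x => (f x).toReal) (Iic t) :=
    integrable_toReal_of_lintegral_ne_top hfm.aemeasurable (by rw [hset]; exact (hfin t).ne)
  have hloc : LocallyIntegrable (fun x => (f x).toReal) volume := fun x =>
    ⟨Iic (x + 1), Iic_mem_nhds (by linarith), hint _⟩
  have hval {t : ℝ} (ht : 0 < t) : ∫ x in (0 : ℝ)..t, (f x).toReal = (M (Iic t)).toReal := by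
    have hIoc : M (Ioc 0 t) = M (Iic t) := by
      refine le_antisymm (measure_mono Ioc_subset_Iic_self) ?_
      calc M (Iic t) ≤ M (Iic 0 ∪ Ioc 0 t) := by rw [Iic_union_Ioc_eq_Iic ht.le]
        _ ≤ M (Iic 0) + M (Ioc 0 t) := measure_union_le _ _
        _ = M (Ioc 0 t) := by rw [h0, zero_add]
    rw [intervalIntegral.integral_of_le ht.le, integral_toReal hfm.aemeasurable, hset, hIoc]
    refine ae_lt_top hfm ?_
    rw [hset, hIoc]
    exact (hfin t).ne
  filter_upwards [ae_restrict_of_ae (LocallyIntegrable.ae_hasDerivAt_integral hloc),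
    ae_restrict_mem measurableSet_Ioi] with t ht ht0
  refine (ht 0).congr_of_eventuallyEq ?_
  filter_upwards [Ioi_mem_nhds ht0] with u hu
  exact (hval hu).symm

lemma eq_withDensity_restrict_Ioi {M : Measure ℝ} [SFinite M] (hac : M ≪ volume)
    (h0 : M (Iic 0) = 0) :
    M = (volume.restrict (Ioi 0)).withDensity (M.rnDeriv volume) := by
  rw [← restrict_withDensity measurableSet_Ioi, Measure.withDensity_rnDeriv_eq _ _ hac,
    Measure.restrict_eq_self_of_ae_mem]
  have : ∀ᵐ x ∂M, x ∉ Iic 0 := measure_eq_zero_iff_ae_notMem.1 h0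
  filter_upwards [this] with x hx
  simpa using hx

lemma ae_rnDeriv_lt_top {M : Measure ℝ}
    (hfin : ∀ t, M (Iic t) < ∞) : ∀ᵐ t, M.rnDeriv volume t < ∞ := by
  have : IsLocallyFiniteMeasure M := ⟨fun x =>
    ⟨Iic (x + 1), Iic_mem_nhds (by linarith), hfin _⟩⟩
  exact Measure.rnDeriv_lt_top _ _

lemma integral_pos_of_ae_pos {μ : Measure ℝ} [IsProbabilityMeasure μ] (hμ : ∀ᵐ x ∂μ, 0 < x)
    (hint : Integrable (fun x => x) μ) : 0 < ∫ x, x ∂μ := by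
  rw [integral_pos_iff_support_of_nonneg_ae (hμ.mono fun x hx => hx.le) hint]
  have : μ (Function.support fun x : ℝ => x) = 1 := by
    rw [prob_compl_eq_zero_iff (s := Function.support fun x : ℝ => x)
      (measurableSet_support measurable_id) |>.symm]
    refine measure_eq_zero_iff_ae_notMem.2 ?_
    filter_upwards [hμ] with x hx
    simp [hx.ne']
  rw [this]; exact one_pos

/-- The measure on `(0, ∞)` with density `-E' / 2`, where `E` is the expected sign; it is meant for
non-increasing `E`, as `ENNReal.ofReal` truncates negative values. -/
def decreaseMeasure {Ω : Type*} [MeasurableSpace Ω] (P : Measure Ω) (τ : ℕ → Ω → ℝ) :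
    Measure ℝ :=
  (volume.restrict (Ioi 0)).withDensity
    fun t => ENNReal.ofReal (-(1 / 2) * deriv (expectedSign P τ) t)

namespace IsAlternatingRenewal

variable {Ω : Type*} [MeasurableSpace Ω] {P : Measure Ω} {τ : ℕ → Ω → ℝ} {a b : Measure ℝ}

lemma sFinite_switchMeasure (h : IsAlternatingRenewal P τ a b) (r : ℕ) :
    SFinite (switchMeasure P τ r) := by
  have := h.indep.isProbabilityMeasure
  unfold switchMeasure
  infer_instance

lemma ae_hasDerivAt_expectedSign (h : IsAlternatingRenewal P τ a b) :
    ∀ᵐ t ∂(volume.restrict (Ioi 0)), HasDerivAt (expectedSign P τ)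
      (-2 * (((switchMeasure P τ 1).rnDeriv volume t).toReal -
        ((switchMeasure P τ 2).rnDeriv volume t).toReal)) t := by
  have := h.sFinite_switchMeasure
  have hE : expectedSign P τ = fun t =>
      1 - 2 * ((switchMeasure P τ 1 (Iic t)).toReal - (switchMeasure P τ 2 (Iic t)).toReal) :=
    funext h.expectedSign_eq
  filter_upwards [ae_hasDerivAt_measure_Iic (h.switchMeasure_absolutelyContinuous le_rfl)
      (h.switchMeasure_Iic_lt_top 1) (h.switchMeasure_Iic_zero le_rfl),
    ae_hasDerivAt_measure_Iic (h.switchMeasure_absolutelyContinuous one_le_two)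
      (h.switchMeasure_Iic_lt_top 2) (h.switchMeasure_Iic_zero one_le_two)] with t h1 h2
  rw [hE]
  refine (((h1.sub h2).const_mul 2).const_sub 1).congr_deriv (by ring)

/-- If the expected sign has nowhere a positive derivative, the intensity of the odd switches
exceeds that of the even switches exactly by `decreaseMeasure`. -/
lemma switchMeasure_one_eq_add (h : IsAlternatingRenewal P τ a b)
    (hsign : ∀ t, 0 < t → DifferentiableAt ℝ (expectedSign P τ) t →
      0 ≤ -deriv (expectedSign P τ) t) :
    switchMeasure P τ 1 = decreaseMeasure P τ + switchMeasure P τ 2 := by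
  have := h.sFinite_switchMeasure
  have hac1 := h.switchMeasure_absolutelyContinuous le_rfl
  have hac2 := h.switchMeasure_absolutelyContinuous one_le_two
  rw [eq_withDensity_restrict_Ioi hac1 (h.switchMeasure_Iic_zero le_rfl)]
  conv_rhs => rw [eq_withDensity_restrict_Ioi hac2 (h.switchMeasure_Iic_zero one_le_two)]
  rw [decreaseMeasure, ← withDensity_add_right _ (Measure.measurable_rnDeriv _ _)]
  refine withDensity_congr_ae ?_
  filter_upwards [h.ae_hasDerivAt_expectedSign, ae_restrict_mem measurableSet_Ioi,
    ae_restrict_of_ae (ae_rnDeriv_lt_top (h.switchMeasure_Iic_lt_top 1)),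
    ae_restrict_of_ae (ae_rnDeriv_lt_top (h.switchMeasure_Iic_lt_top 2))]
    with t ht ht0 h1 h2
  have hs := hsign t ht0 ht.differentiableAt
  rw [ht.deriv] at hs
  simp only [Pi.add_apply, ht.deriv]
  generalize (switchMeasure P τ 1).rnDeriv volume t = x at *
  generalize (switchMeasure P τ 2).rnDeriv volume t = y at *
  lift x to ℝ≥0 using h1.ne
  lift y to ℝ≥0 using h2.ne
  rw [ENNReal.coe_toReal, ENNReal.coe_toReal] at hs ⊢
  rw [← ENNReal.ofReal_coe_nnreal, ← ENNReal.ofReal_coe_nnreal (p := y),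
    ← ENNReal.ofReal_add (by linarith) y.coe_nonneg]
  congr 1
  ring

lemma laplace_decreaseMeasure (h : IsAlternatingRenewal P τ a b)
    (hsign : ∀ t, 0 < t → DifferentiableAt ℝ (expectedSign P τ) t →
      0 ≤ -deriv (expectedSign P τ) t) {s : ℝ} (hs : 0 < s) :
    laplace (decreaseMeasure P τ) s = ENNReal.ofReal
      ((laplace a s).toReal * (1 - (laplace b s).toReal) /
        (1 - (laplace a s).toReal * (laplace b s).toReal)) := by
  have hadd := congrArg (fun M => laplace M s) (h.switchMeasure_one_eq_add hsign)
  have h1 := h.laplace_switchMeasure_lt_top 1 hs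
  have h2 := h.laplace_switchMeasure_lt_top 2 hs
  simp only [laplace_add] at hadd
  have h0 : laplace (decreaseMeasure P τ) s ≠ ∞ := by
    refine ((le_add_right le_rfl).trans_lt (?_ : _ + laplace (switchMeasure P τ 2) s < ∞)).ne
    rw [← hadd]; exact h1
  rw [← ENNReal.ofReal_toReal h0]
  congr 1
  have hr := congrArg ENNReal.toReal hadd
  rw [ENNReal.toReal_add h0 h2.ne, h.laplace_switchMeasure, h.laplace_switchMeasure,
    h.laplace_partialSum, h.laplace_partialSum, Finset.prod_range_one, Finset.prod_range_succ,
    Finset.prod_range_one, if_pos Even.zero, if_neg Nat.not_even_one] at hr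
  have hlt := h.laplace_mul_lt_one hs
  have hlt' : (laplace a s).toReal * (laplace b s).toReal < 1 := by
    rw [← ENNReal.toReal_mul, ← ENNReal.toReal_one]
    exact (ENNReal.toReal_lt_toReal (hlt.trans ENNReal.one_lt_top).ne ENNReal.one_ne_top).2 hlt
  simp only [ENNReal.toReal_mul, ENNReal.toReal_inv,
    ENNReal.toReal_sub_of_le hlt.le ENNReal.one_ne_top, ENNReal.toReal_one] at hr
  rw [eq_div_iff (by linarith)]
  have hne : 1 - (laplace a s).toReal * (laplace b s).toReal ≠ 0 := by linarith
  field_simp at hr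
  linarith

/-- The total mass is the limit at `s → 0` of the Laplace transform. -/
lemma decreaseMeasure_univ (h : IsAlternatingRenewal P τ a b)
    (hsign : ∀ t, 0 < t → DifferentiableAt ℝ (expectedSign P τ) t →
      0 ≤ -deriv (expectedSign P τ) t)
    (ha : Integrable (fun x => x) a) (hb : Integrable (fun x => x) b) :
    decreaseMeasure P τ univ =
      ENNReal.ofReal ((∫ x, x ∂b) / ((∫ x, x ∂a) + ∫ x, x ∂b)) := by
  have := h.isProbabilityMeasure_even
  have := h.isProbabilityMeasure_odd
  have hpos : ∀ᵐ x ∂(decreaseMeasure P τ), 0 ≤ x := by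
    refine (withDensity_absolutelyContinuous _ _).ae_le ?_
    filter_upwards [ae_restrict_mem measurableSet_Ioi] with x hx using le_of_lt hx
  refine tendsto_nhds_unique (tendsto_laplace_measure_univ hpos) ?_
  have hs (n : ℕ) : (0 : ℝ) < 1 / ((n : ℝ) + 1) := by positivity
  simp_rw [h.laplace_decreaseMeasure hsign (hs _)]
  refine ENNReal.tendsto_ofReal ?_
  have ha0 := h.pos_even.mono fun x hx => hx.le
  have hA := (ENNReal.tendsto_toReal (measure_ne_top a univ)).comp
    (tendsto_laplace_measure_univ ha0)
  have hA' := tendsto_one_sub_laplace_div ha0 ha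
  have hB' := tendsto_one_sub_laplace_div (h.pos_odd.mono fun x hx => hx.le) hb
  rw [measure_univ, ENNReal.toReal_one] at hA
  have hma := integral_pos_of_ae_pos h.pos_even ha
  have hmb := integral_pos_of_ae_pos h.pos_odd hb
  have hlim := (hA.mul hB').div (hA'.add (hA.mul hB')) (by rw [one_mul]; linarith)
  rw [one_mul] at hlim
  refine hlim.congr fun n => ?_
  have hn : (n : ℝ) + 1 ≠ 0 := by positivity
  simp only [Function.comp, Pi.div_apply]
  -- `1 - AB = (1 - A) + A (1 - B)`
  rw [← mul_div_mul_right (_ * (1 - _)) (1 - _) hn]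
  congr 1 <;> ring

end IsAlternatingRenewal

/-! ### Geometric sums -/

lemma IsGeometric.map_singleton {Ω : Type*} [MeasurableSpace Ω] {P : Measure Ω} {ν : Ω → ℕ}
    {p : ℝ} (hν : IsGeometric P ν p) (k : ℕ) :
    (P.map ν) {k + 1} = ENNReal.ofReal ((1 - p) ^ k * p) := by
  rw [Measure.map_apply hν.1 (measurableSet_singleton _), ← hν.2 k]; rfl

/-- The masses on `{1, 2, …}` add up to one, so a geometric variable is almost surely positive. -/
lemma IsGeometric.map_singleton_zero {Ω : Type*} [MeasurableSpace Ω] {P : Measure Ω}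
    [IsProbabilityMeasure P] {ν : Ω → ℕ} {p : ℝ} (hν : IsGeometric P ν p) (hp : 0 < p)
    (hp1 : p ≤ 1) : (P.map ν) {0} = 0 := by
  have hpm : IsProbabilityMeasure (P.map ν) := Measure.isProbabilityMeasure_map hν.1.aemeasurable
  have hsum : ∑' n, (P.map ν) {n} = 1 := by
    have := lintegral_countable' (μ := P.map ν) (fun _ => 1)
    simp only [lintegral_one, measure_univ, one_mul] at this
    exact this.symm
  rw [tsum_eq_zero_add' ENNReal.summable] at hsum
  have h1 : ∑' k, (P.map ν) {k + 1} = 1 := by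
    simp_rw [hν.map_singleton]
    have hs : HasSum (fun k : ℕ => (1 - p) ^ k * p) ((1 - (1 - p))⁻¹ * p) :=
      (hasSum_geometric_of_lt_one (by linarith) (by linarith)).mul_right p
    rw [← ENNReal.ofReal_tsum_of_nonneg (fun k => mul_nonneg (pow_nonneg (by linarith) k) hp.le)
      hs.summable, hs.tsum_eq]
    have : (1 - (1 - p))⁻¹ * p = 1 := by rw [sub_sub_cancel, inv_mul_cancel₀ hp.ne']
    rw [this, ENNReal.ofReal_one]
  rw [h1] at hsum
  simpa using hsum

/-- The probability generating function of the geometric distribution on `{1, 2, …}`. -/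
lemma IsGeometric.lintegral_pow {Ω : Type*} [MeasurableSpace Ω] {P : Measure Ω}
    [IsProbabilityMeasure P] {ν : Ω → ℕ} {p x : ℝ} (hν : IsGeometric P ν p) (hp : 0 < p)
    (hp1 : p ≤ 1) (hx : 0 ≤ x) (hx1 : x ≤ 1) :
    ∫⁻ ω, ENNReal.ofReal x ^ ν ω ∂P = ENNReal.ofReal (p * x / (1 - (1 - p) * x)) := by
  have hlt : (1 - p) * x < 1 := by nlinarith
  rw [← lintegral_map (μ := P) (f := fun n : ℕ => ENNReal.ofReal x ^ n)
    (measurable_of_countable _) hν.1, lintegral_countable', tsum_eq_zero_add' ENNReal.summable,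
    hν.map_singleton_zero hp hp1, mul_zero, zero_add]
  simp_rw [hν.map_singleton]
  have hterm (k : ℕ) : ENNReal.ofReal x ^ (k + 1) * ENNReal.ofReal ((1 - p) ^ k * p) =
      ENNReal.ofReal (((1 - p) * x) ^ k * (p * x)) := by
    rw [← ENNReal.ofReal_pow hx, ← ENNReal.ofReal_mul (pow_nonneg hx _)]
    congr 1
    rw [mul_pow]
    ring
  have h0 : 0 ≤ (1 - p) * x := mul_nonneg (by linarith) hx
  have hs : HasSum (fun k : ℕ => ((1 - p) * x) ^ k * (p * x)) ((1 - (1 - p) * x)⁻¹ * (p * x)) :=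
    (hasSum_geometric_of_lt_one h0 hlt).mul_right _
  simp_rw [hterm]
  rw [← ENNReal.ofReal_tsum_of_nonneg (fun k => mul_nonneg (pow_nonneg h0 k) (by positivity))
    hs.summable, hs.tsum_eq, inv_mul_eq_div]

lemma measurable_sum_range {Ω : Type*} [MeasurableSpace Ω] {ν : Ω → ℕ} {X : ℕ → Ω → ℝ}
    (hν : Measurable ν) (hX : ∀ k, Measurable (X k)) :
    Measurable fun ω => ∑ k ∈ Finset.range (ν ω), X k ω := by
  have : Measurable fun q : ℕ × Ω => ∑ k ∈ Finset.range q.1, X k q.2 :=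
    measurable_from_prod_countable_right fun n =>
      Finset.measurable_fun_sum (Finset.range n) fun k _ => hX k
  exact this.comp (hν.prodMk measurable_id)

lemma HasDensity.ae_nonneg {Ω : Type*} [MeasurableSpace Ω] {P : Measure Ω} {V : Ω → ℝ}
    {f : ℝ → ℝ} (hV : HasDensity P V f) : ∀ᵐ x ∂(P.map V), 0 ≤ x := by
  rw [hV.2]
  refine (withDensity_absolutelyContinuous _ _).ae_le ?_
  filter_upwards [ae_restrict_mem measurableSet_Ioi] with x hx using le_of_lt hx

lemma HasDensity.laplace_le_one {Ω : Type*} [MeasurableSpace Ω] {P : Measure Ω}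
    [IsProbabilityMeasure P] {V : Ω → ℝ} {f : ℝ → ℝ} (hV : HasDensity P V f) {s : ℝ}
    (hs : 0 ≤ s) : laplace (P.map V) s ≤ 1 := by
  have := Measure.isProbabilityMeasure_map (μ := P) hV.1.aemeasurable
  exact (laplace_le_measure_univ hV.ae_nonneg hs).trans_eq measure_univ

namespace IsGeometricSumData

variable {Ω : Type*} [MeasurableSpace Ω] {P : Measure Ω} {α β : ℝ} {fX fY : ℝ → ℝ}
  {να νβ : Ω → ℕ} {X Y : ℕ → Ω → ℝ}

lemma measurable_geometricSum (h : IsGeometricSumData P α β fX fY να νβ X Y) :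
    Measurable (geometricSum να νβ X Y) :=
  (measurable_sum_range h.geometric_beta.1 fun k => (h.density_X k).1).add
    (measurable_sum_range h.geometric_alpha.1 fun k => (h.density_Y k).1)

lemma measurable_terms (h : IsGeometricSumData P α β fX fY να νβ X Y) (i : ℕ ⊕ ℕ) :
    Measurable (Sum.elim X Y i) := by
  rcases i with k | k
  exacts [(h.density_X k).1, (h.density_Y k).1]

lemma ae_geometricSum_nonneg (h : IsGeometricSumData P α β fX fY να νβ X Y) :
    ∀ᵐ ω ∂P, 0 ≤ geometricSum να νβ X Y ω := by
  have hpos {V : Ω → ℝ} {f : ℝ → ℝ} (hV : HasDensity P V f) : ∀ᵐ ω ∂P, 0 ≤ V ω :=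
    ae_of_ae_map hV.1.aemeasurable hV.ae_nonneg
  filter_upwards [ae_all_iff.2 fun k => hpos (h.density_X k),
    ae_all_iff.2 fun k => hpos (h.density_Y k)] with ω hX hY
  exact add_nonneg (Finset.sum_nonneg fun k _ => hX k) (Finset.sum_nonneg fun k _ => hY k)

lemma laplace_geometricSum [IsProbabilityMeasure P]
    (h : IsGeometricSumData P α β fX fY να νβ X Y)
    (hα : 0 < α) (hα1 : α ≤ 1) (hβ : 0 < β) (hβ1 : β ≤ 1) {s x y : ℝ}
    (hx : 0 ≤ x) (hx1 : x ≤ 1) (hy : 0 ≤ y) (hy1 : y ≤ 1)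
    (hX : ∀ k, laplace (P.map (X k)) s = ENNReal.ofReal x)
    (hY : ∀ k, laplace (P.map (Y k)) s = ENNReal.ofReal y) :
    laplace (P.map (geometricSum να νβ X Y)) s =
      ENNReal.ofReal (β * x / (1 - (1 - β) * x)) * ENNReal.ofReal (α * y / (1 - (1 - α) * y)) := by
  let N : Ω → ℕ × ℕ := fun ω => (να ω, νβ ω)
  let Z : Ω → (ℕ → ℝ) × (ℕ → ℝ) := fun ω => (fun k => X k ω, fun k => Y k ω)
  have hN : Measurable N := h.geometric_alpha.1.prodMk h.geometric_beta.1
  have hZ : Measurable Z := (measurable_pi_lambda _ fun k => (h.density_X k).1).prodMk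
    (measurable_pi_lambda _ fun k => (h.density_Y k).1)
  let S (n : ℕ × ℕ) (z : (ℕ → ℝ) × (ℕ → ℝ)) : ℝ :=
    ∑ k ∈ Finset.range n.2, z.1 k + ∑ k ∈ Finset.range n.1, z.2 k
  have hS (n : ℕ × ℕ) : Measurable (S n) := by fun_prop
  have hSm : Measurable fun q : (ℕ × ℕ) × ((ℕ → ℝ) × (ℕ → ℝ)) => S q.1 q.2 :=
    measurable_from_prod_countable_right hS
  have hinner (n : ℕ × ℕ) :
      ∫⁻ z, ENNReal.ofReal (Real.exp (-(s * S n z))) ∂(P.map Z) =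
        ENNReal.ofReal x ^ n.2 * ENNReal.ofReal y ^ n.1 := by
    rw [lintegral_map (f := fun z => ENNReal.ofReal (Real.exp (-(s * S n z))))
      ((measurable_laplaceKernel s).comp (hS n)) hZ]
    have := laplace_map_finsetSum h.measurable_terms h.indep_terms
      ((Finset.range n.2).disjSum (Finset.range n.1)) s
    rw [Finset.prod_disjSum] at this
    simp only [Finset.sum_disjSum, Sum.elim_inl, Sum.elim_inr, hX, hY, Finset.prod_const,
      Finset.card_range] at this
    rw [← this, laplace_map]
    exact (Measurable.add (Finset.measurable_fun_sum _ fun k _ => (h.density_X k).1)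
      (Finset.measurable_fun_sum _ fun k _ => (h.density_Y k).1)).aemeasurable
  rw [laplace_map h.measurable_geometricSum.aemeasurable]
  have hpair := (indepFun_iff_map_prod_eq_prod_map_map hN.aemeasurable hZ.aemeasurable).1
    h.indep_counts_terms
  calc ∫⁻ ω, ENNReal.ofReal (Real.exp (-(s * geometricSum να νβ X Y ω))) ∂P
      = ∫⁻ q, ENNReal.ofReal (Real.exp (-(s * S q.1 q.2))) ∂(P.map fun ω => (N ω, Z ω)) := by
        rw [lintegral_map (f := fun q : (ℕ × ℕ) × ((ℕ → ℝ) × (ℕ → ℝ)) =>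
            ENNReal.ofReal (Real.exp (-(s * S q.1 q.2))))
          ((measurable_laplaceKernel s).comp hSm) (hN.prodMk hZ)]
        rfl
    _ = ∫⁻ n, ∫⁻ z, ENNReal.ofReal (Real.exp (-(s * S n z))) ∂(P.map Z) ∂(P.map N) := by
        rw [hpair]
        exact lintegral_prod _ ((measurable_laplaceKernel s).comp hSm).aemeasurable
    _ = ∫⁻ ω, ENNReal.ofReal x ^ νβ ω * ENNReal.ofReal y ^ να ω ∂P := by
        simp_rw [hinner]
        rw [lintegral_map (measurable_of_countable _) hN]
    _ = (∫⁻ ω, ENNReal.ofReal x ^ νβ ω ∂P) * ∫⁻ ω, ENNReal.ofReal y ^ να ω ∂P :=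
        lintegral_mul_eq_lintegral_mul_lintegral_of_indepFun
          ((measurable_of_countable fun n : ℕ => ENNReal.ofReal x ^ n).comp h.geometric_beta.1)
          ((measurable_of_countable fun n : ℕ => ENNReal.ofReal y ^ n).comp h.geometric_alpha.1)
          (h.indep_counts.symm.comp (measurable_of_countable fun n : ℕ => ENNReal.ofReal x ^ n)
            (measurable_of_countable fun n : ℕ => ENNReal.ofReal y ^ n))
    _ = _ := by
        rw [h.geometric_beta.lintegral_pow hβ hβ1 hx hx1,
          h.geometric_alpha.lintegral_pow hα hα1 hy hy1]

end IsGeometricSumData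

/-- The product space of the two geometric laws and countably many copies of the laws of the terms
carries the required variables. -/
theorem exists_isGeometricSumData {α β : ℝ} (hα : 0 < α) (hα1 : α ≤ 1) (hβ : 0 < β)
    (hβ1 : β ≤ 1) {fX fY : ℝ → ℝ}
    (hX : IsProbabilityMeasure
      ((volume.restrict (Ioi 0)).withDensity fun t => ENNReal.ofReal (fX t)))
    (hY : IsProbabilityMeasure
      ((volume.restrict (Ioi 0)).withDensity fun t => ENNReal.ofReal (fY t))) :
    ∃ (Ω' : Type) (_ : MeasurableSpace Ω') (P' : Measure Ω') (να νβ : Ω' → ℕ)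
      (X Y : ℕ → Ω' → ℝ), IsProbabilityMeasure P' ∧
        IsGeometricSumData P' α β fX fY να νβ X Y := by
  let pα : unitInterval := ⟨α, hα.le, hα1⟩
  let pβ : unitInterval := ⟨β, hβ.le, hβ1⟩
  let γ : Measure (ℕ × ℕ) := (geometricMeasure pα).prod (geometricMeasure pβ)
  let κ (i : ℕ ⊕ ℕ) : Measure ℝ := Sum.elim
    (fun _ => (volume.restrict (Ioi 0)).withDensity fun t => ENNReal.ofReal (fX t))
    (fun _ => (volume.restrict (Ioi 0)).withDensity fun t => ENNReal.ofReal (fY t)) i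
  have hκ (i : ℕ ⊕ ℕ) : IsProbabilityMeasure (κ i) := by
    rcases i with i | i
    exacts [hX, hY]
  let P' : Measure ((ℕ × ℕ) × (ℕ ⊕ ℕ → ℝ)) := γ.prod (Measure.infinitePi κ)
  have hfst : P'.map Prod.fst = γ := by simp [P']
  have hsnd : P'.map Prod.snd = Measure.infinitePi κ := by simp [P']
  have hlaw (i : ℕ ⊕ ℕ) : P'.map (fun ω => ω.2 i) = κ i := by
    have := Measure.map_map (μ := P') (measurable_pi_apply i) measurable_snd
    rw [hsnd, Measure.infinitePi_map_eval] at this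
    exact this.symm
  have hgeom {p : unitInterval} (hp : p ≠ 0) {f : ℕ × ℕ → ℕ}
      (hf : γ.map f = geometricMeasure p) : IsGeometric P' (fun ω => f ω.1 + 1) (p : ℝ) := by
    have hfm : Measurable f := measurable_of_countable _
    refine ⟨by fun_prop, fun k => ?_⟩
    have : {ω : (ℕ × ℕ) × (ℕ ⊕ ℕ → ℝ) | f ω.1 + 1 = k + 1} = Prod.fst ⁻¹' (f ⁻¹' {k}) := by
      ext ω; simp
    rw [this, ← Measure.map_apply measurable_fst (hfm (measurableSet_singleton k)), hfst,
      ← Measure.map_apply hfm (measurableSet_singleton k), hf, geometricMeasure_singleton hp]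
  have hind : IndepFun (fun ω => ω.1) (fun ω => ω.2) P' := by
    refine (indepFun_iff_map_prod_eq_prod_map_map (by fun_prop) (by fun_prop)).2 ?_
    rw [hfst, hsnd]
    exact Measure.map_id
  have hpα : pα ≠ 0 := fun h => hα.ne' (congrArg Subtype.val h)
  have hpβ : pβ ≠ 0 := fun h => hβ.ne' (congrArg Subtype.val h)
  refine ⟨(ℕ × ℕ) × (ℕ ⊕ ℕ → ℝ), inferInstance, P', fun ω => ω.1.1 + 1, fun ω => ω.1.2 + 1,
    fun k ω => ω.2 (Sum.inl k), fun k ω => ω.2 (Sum.inr k), inferInstance, ?_⟩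
  refine ⟨hgeom hpα (by simp [γ]), hgeom hpβ (by simp [γ]), fun k => ⟨by fun_prop, hlaw _⟩,
    fun k => ⟨by fun_prop, hlaw _⟩, ?_, ?_, ?_⟩
  -- independence of the counts passes from `γ` to its pullback under the first projection
  · have h12 : IndepFun (fun n : ℕ × ℕ => n.1) (fun n => n.2) γ := by
      refine (indepFun_iff_map_prod_eq_prod_map_map (by fun_prop) (by fun_prop)).2 ?_
      simp only [γ, Measure.map_fst_prod, Measure.map_snd_prod, measure_univ, one_smul]
      exact Measure.map_id
    have hcomp : IndepFun (fun ω : (ℕ × ℕ) × (ℕ ⊕ ℕ → ℝ) => ω.1.1) (fun ω => ω.1.2) P' := by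
      rw [← hfst] at h12
      refine (indepFun_iff_map_prod_eq_prod_map_map (by fun_prop) (by fun_prop)).2 ?_
      have := (indepFun_iff_map_prod_eq_prod_map_map (by fun_prop) (by fun_prop)).1 h12
      rw [Measure.map_map (by fun_prop) (by fun_prop), Measure.map_map (by fun_prop) (by fun_prop),
        Measure.map_map (by fun_prop) (by fun_prop)] at this
      exact this
    exact hcomp.comp (φ := fun n => n + 1) (ψ := fun n => n + 1) (by fun_prop) (by fun_prop)
  · have hfun : (fun i : ℕ ⊕ ℕ => Sum.elim
        (fun k (ω : (ℕ × ℕ) × (ℕ ⊕ ℕ → ℝ)) => ω.2 (Sum.inl k)) (fun k ω => ω.2 (Sum.inr k)) i) =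
        fun i ω => ω.2 i := by
      ext i ω; rcases i with i | i <;> rfl
    rw [hfun, iIndepFun_iff_map_fun_eq_infinitePi_map (by fun_prop)]
    simp_rw [hlaw]
    exact hsnd
  · exact hind.comp (φ := fun n : ℕ × ℕ => (n.1 + 1, n.2 + 1))
      (ψ := fun z : ℕ ⊕ ℕ → ℝ => ((fun k => z (Sum.inl k)), (fun k => z (Sum.inr k))))
      (by fun_prop) (by fun_prop)

/-! ### Conditioning a switch process on its starting state -/

/-- The sequence `A₀, B₀, A₁, B₁, …`. -/
def interlace {Ω : Type*} (A B : ℕ → Ω → ℝ) (n : ℕ) : Ω → ℝ :=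
  if Even n then A (n / 2) else B (n / 2)

lemma isAlternatingRenewal_interlace {Ω : Type*} [MeasurableSpace Ω] {Q : Measure Ω}
    {A B : ℕ → Ω → ℝ} {a b : Measure ℝ} (hA : ∀ i, Measurable (A i)) (hB : ∀ i, Measurable (B i))
    (hind : iIndepFun (Sum.elim A B) Q) (hAl : ∀ i, Q.map (A i) = a) (hBl : ∀ i, Q.map (B i) = b)
    (ha : a ≪ volume) (hb : b ≪ volume) (ha0 : ∀ᵐ x ∂a, 0 < x) (hb0 : ∀ᵐ x ∂b, 0 < x) :
    IsAlternatingRenewal Q (interlace A B) a b where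
  measurable n := by
    unfold interlace
    split_ifs
    exacts [hA _, hB _]
  indep := by
    let g (n : ℕ) : ℕ ⊕ ℕ := if Even n then Sum.inl (n / 2) else Sum.inr (n / 2)
    have hg : Function.Injective g := by
      intro m n hmn
      by_cases hm : Even m <;> by_cases hn : Even n <;> simp only [g, hm, hn, if_true, if_false,
        Sum.inl.injEq, Sum.inr.injEq, reduceCtorEq] at hmn
      · rw [Nat.even_iff] at hm hn; omega
      · rw [Nat.not_even_iff] at hm hn; omega
    have hfun : interlace A B = fun n => Sum.elim A B (g n) := by
      ext n : 1
      by_cases hn : Even n <;> simp [interlace, g, hn]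
    rw [hfun]
    exact hind.precomp hg
  law n := by
    unfold interlace
    split_ifs
    exacts [hAl _, hBl _]
  ac_even := ha
  ac_odd := hb
  pos_even := ha0
  pos_odd := hb0

lemma map_cond_eq {Ω E : Type*} [MeasurableSpace Ω] [MeasurableSpace E] {P : Measure Ω}
    [IsProbabilityMeasure P] {δ : Ω → ℝ} {Z : Ω → E} (hδ : Measurable δ) (hZ : Measurable Z)
    (hind : IndepFun δ Z P) {c : ℝ} (hc : P {ω | δ ω = c} ≠ 0) :
    (ProbabilityTheory.cond P {ω | δ ω = c}).map Z = P.map Z := by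
  have hm : MeasurableSet {ω | δ ω = c} := hδ (measurableSet_singleton c)
  ext u hu
  rw [Measure.map_apply hZ hu, Measure.map_apply hZ hu, cond_apply hm,
    show {ω | δ ω = c} = δ ⁻¹' {c} from rfl,
    hind.measure_inter_preimage_eq_mul {c} u (measurableSet_singleton c) hu, ← mul_assoc,
    ENNReal.inv_mul_cancel (show P (δ ⁻¹' {c}) ≠ 0 from hc) (measure_ne_top _ _), one_mul]

lemma ae_pos_of_ac {μ : Measure ℝ} (hac : μ ≪ volume) (h0 : ∀ᵐ x ∂μ, 0 ≤ x) :
    ∀ᵐ x ∂μ, 0 < x := by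
  have hne : ∀ᵐ x ∂μ, x ≠ 0 := hac.ae_le (Measure.ae_ne volume 0)
  filter_upwards [h0, hne] with x hx hx0 using lt_of_le_of_ne hx hx0.symm

namespace IsSwitchData

variable {Ω : Type*} [MeasurableSpace Ω] {P : Measure Ω} {δ : Ω → ℝ} {Tp Tm : ℕ → Ω → ℝ}

lemma measurable_times (h : IsSwitchData P δ Tp Tm) (i : ℕ ⊕ ℕ) :
    Measurable (Sum.elim Tp Tm i) := by
  rcases i with i | i
  exacts [h.measurable_plus i, h.measurable_minus i]

lemma indepFun_delta_times (h : IsSwitchData P δ Tp Tm) :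
    IndepFun δ (fun ω i => Sum.elim Tp Tm i ω) P := by
  have := h.indep_delta.comp (φ := id)
    (ψ := fun z : (ℕ → ℝ) × (ℕ → ℝ) => fun i : ℕ ⊕ ℕ => Sum.elim z.1 z.2 i) measurable_id
    (measurable_pi_lambda _ fun i => by rcases i with i | i <;> simp <;> fun_prop)
  have hfun : (fun ω i => Sum.elim Tp Tm i ω) =
      (fun z : (ℕ → ℝ) × (ℕ → ℝ) => fun i : ℕ ⊕ ℕ => Sum.elim z.1 z.2 i) ∘
        fun ω => ((fun i => Tp i ω), (fun i => Tm i ω)) := by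
    funext ω i
    rcases i with i | i <;> rfl
  rw [hfun]
  exact this

lemma pos_plus_law (h : IsSwitchData P δ Tp Tm) : ∀ᵐ x ∂(P.map (Tp 0)), 0 < x :=
  ae_pos_of_ac h.absolutelyContinuous_plus
    ((ae_map_iff (h.measurable_plus 0).aemeasurable measurableSet_Ici).2 h.nonneg_plus)

lemma pos_minus_law (h : IsSwitchData P δ Tp Tm) : ∀ᵐ x ∂(P.map (Tm 0)), 0 < x :=
  ae_pos_of_ac h.absolutelyContinuous_minus
    ((ae_map_iff (h.measurable_minus 0).aemeasurable measurableSet_Ici).2 h.nonneg_minus)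

variable [IsProbabilityMeasure P]

lemma map_cond_times (h : IsSwitchData P δ Tp Tm) {c : ℝ} (hc : P {ω | δ ω = c} ≠ 0)
    (i : ℕ ⊕ ℕ) :
    (ProbabilityTheory.cond P {ω | δ ω = c}).map (Sum.elim Tp Tm i) =
      P.map (Sum.elim Tp Tm i) :=
  map_cond_eq h.measurable_delta (h.measurable_times i)
    (h.indepFun_delta_times.comp (φ := id) (ψ := fun z : ℕ ⊕ ℕ → ℝ => z i)
      measurable_id (measurable_pi_apply i)) hc

/-- Conditioning on the starting state does not change the joint law of the times. -/
lemma iIndepFun_cond (h : IsSwitchData P δ Tp Tm) {c : ℝ} (hc : P {ω | δ ω = c} ≠ 0) :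
    iIndepFun (Sum.elim Tp Tm) (ProbabilityTheory.cond P {ω | δ ω = c}) := by
  have := cond_isProbabilityMeasure hc
  rw [iIndepFun_iff_map_fun_eq_infinitePi_map h.measurable_times]
  simp_rw [h.map_cond_times hc]
  rw [map_cond_eq h.measurable_delta (measurable_pi_lambda _ h.measurable_times)
    h.indepFun_delta_times hc]
  exact (iIndepFun_iff_map_fun_eq_infinitePi_map h.measurable_times).1 h.indep_times

lemma isAlternatingRenewal_plus (h : IsSwitchData P δ Tp Tm) :
    IsAlternatingRenewal (ProbabilityTheory.cond P {ω | δ ω = 1}) (interlace Tp Tm)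
      (P.map (Tp 0)) (P.map (Tm 0)) :=
  isAlternatingRenewal_interlace h.measurable_plus h.measurable_minus
    (h.iIndepFun_cond h.pos_plus.ne')
    (fun i => (h.map_cond_times h.pos_plus.ne' (Sum.inl i)).trans (h.identDistrib_plus i).map_eq)
    (fun i => (h.map_cond_times h.pos_plus.ne' (Sum.inr i)).trans (h.identDistrib_minus i).map_eq)
    h.absolutelyContinuous_plus h.absolutelyContinuous_minus h.pos_plus_law h.pos_minus_law

lemma isAlternatingRenewal_minus (h : IsSwitchData P δ Tp Tm) :
    IsAlternatingRenewal (ProbabilityTheory.cond P {ω | δ ω = -1}) (interlace Tm Tp)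
      (P.map (Tm 0)) (P.map (Tp 0)) := by
  have hswap : Sum.elim Tm Tp = fun i => Sum.elim Tp Tm i.swap := by
    ext i : 1
    rcases i with i | i <;> rfl
  refine isAlternatingRenewal_interlace h.measurable_minus h.measurable_plus ?_
    (fun i => (h.map_cond_times h.pos_minus.ne' (Sum.inr i)).trans (h.identDistrib_minus i).map_eq)
    (fun i => (h.map_cond_times h.pos_minus.ne' (Sum.inl i)).trans (h.identDistrib_plus i).map_eq)
    h.absolutelyContinuous_minus h.absolutelyContinuous_plus h.pos_minus_law h.pos_plus_law
  rw [hswap]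
  exact (h.iIndepFun_cond h.pos_minus.ne').precomp (Equiv.sumComm ℕ ℕ).injective

omit [IsProbabilityMeasure P] in
lemma expectedValue_one (h : IsSwitchData P δ Tp Tm) :
    expectedValue P δ Tp Tm 1 =
      expectedSign (ProbabilityTheory.cond P {ω | δ ω = 1}) (interlace Tp Tm) := by
  ext t
  refine integral_congr_ae ?_
  filter_upwards [ae_cond_mem (h.measurable_delta (measurableSet_singleton 1))] with ω hω
  have hω : δ ω = 1 := hω
  have hs (n : ℕ) : switchTime δ Tp Tm n ω = partialSum (interlace Tp Tm) n ω := by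
    refine Finset.sum_congr rfl fun i _ => ?_
    simp only [sojourn, interlace, hω, if_true]
    split_ifs <;> rfl
  simp only [process, switchCount, hs, hω, one_mul]

omit [IsProbabilityMeasure P] in
lemma expectedValue_neg_one (h : IsSwitchData P δ Tp Tm) :
    expectedValue P δ Tp Tm (-1) = fun t =>
      -expectedSign (ProbabilityTheory.cond P {ω | δ ω = -1}) (interlace Tm Tp) t := by
  ext t
  rw [expectedSign, ← integral_neg]
  refine integral_congr_ae ?_
  filter_upwards [ae_cond_mem (h.measurable_delta (measurableSet_singleton (-1)))] with ω hω
  have hω : δ ω = -1 := hω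
  have hs (n : ℕ) : switchTime δ Tp Tm n ω = partialSum (interlace Tm Tp) n ω := by
    refine Finset.sum_congr rfl fun i _ => ?_
    have h1 : ¬ (-1 : ℝ) = 1 := by norm_num
    simp only [sojourn, interlace, hω, h1, if_false]
    split_ifs <;> rfl
  simp only [process, switchCount, hs, hω, neg_mul, one_mul]

lemma map_minus_add_plus (h : IsSwitchData P δ Tp Tm) (i j : ℕ) :
    P.map (fun ω => Tm i ω + Tp j ω) = P.map (fun ω => Tm 0 ω + Tp 0 ω) := by
  have key (i j : ℕ) : P.map (fun ω => Tm i ω + Tp j ω) =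
      (P.map (Tm 0)).conv (P.map (Tp 0)) := by
    have hind : IndepFun (Tm i) (Tp j) P :=
      h.indep_times.indepFun (i := Sum.inr i) (j := Sum.inl j) (by simp)
    rw [← (h.identDistrib_minus i).map_eq, ← (h.identDistrib_plus j).map_eq]
    exact hind.map_add_eq_map_conv_map₀ (h.measurable_minus i).aemeasurable
      (h.measurable_plus j).aemeasurable
  rw [key, key]

omit [IsProbabilityMeasure P] in
lemma measurable_sojourn (h : IsSwitchData P δ Tp Tm) (n : ℕ) :
    Measurable (sojourn δ Tp Tm n) := by
  unfold sojourn
  refine Measurable.ite (h.measurable_delta (measurableSet_singleton 1)) ?_ ?_ <;>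
  · split_ifs
    exacts [by first | exact h.measurable_plus _ | exact h.measurable_minus _,
      by first | exact h.measurable_plus _ | exact h.measurable_minus _]

/-- Two consecutive sojourns consist of one `Tm` and one `Tp`; their indices depend on `δ`, but the
law of the sum does not, and `δ` is independent of the times. -/
lemma map_switchTime_sub (h : IsSwitchData P δ Tp Tm) (n : ℕ) :
    P.map (fun ω => switchTime δ Tp Tm (n + 2) ω - switchTime δ Tp Tm n ω) =
      P.map (fun ω => Tm 0 ω + Tp 0 ω) := by
  have hdiff (ω : Ω) : switchTime δ Tp Tm (n + 2) ω - switchTime δ Tp Tm n ω =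
      sojourn δ Tp Tm n ω + sojourn δ Tp Tm (n + 1) ω := by
    simp only [switchTime, Finset.sum_range_succ]
    ring
  -- on each of the two events `δ = ±1` the cycle consists of one `Tm` and one `Tp`
  have hcase : ∃ i j i' j' : ℕ, ∀ ω, sojourn δ Tp Tm n ω + sojourn δ Tp Tm (n + 1) ω =
      if δ ω = 1 then Tm i ω + Tp j ω else Tm i' ω + Tp j' ω := by
    rcases Nat.even_or_odd n with hn | hn
    · have hn1 : ¬ Even (n + 1) := by simp [Nat.even_add_one, hn]
      refine ⟨(n + 1) / 2, n / 2, n / 2, (n + 1) / 2, fun ω => ?_⟩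
      simp only [sojourn, hn, hn1, if_true, if_false]
      split_ifs <;> ring
    · have hn0 : ¬ Even n := Nat.not_even_iff_odd.2 hn
      have hn1 : Even (n + 1) := by simp [Nat.even_add_one, hn0]
      refine ⟨n / 2, (n + 1) / 2, (n + 1) / 2, n / 2, fun ω => ?_⟩
      simp only [sojourn, hn0, hn1, if_true, if_false]
      split_ifs <;> ring
  obtain ⟨i, j, i', j', hcase⟩ := hcase
  have hm : Measurable fun ω => switchTime δ Tp Tm (n + 2) ω - switchTime δ Tp Tm n ω := by
    simp_rw [hdiff]
    exact (h.measurable_sojourn n).add (h.measurable_sojourn (n + 1))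
  have hsum (i j : ℕ) : Measurable fun ω => Tm i ω + Tp j ω :=
    (h.measurable_minus i).add (h.measurable_plus j)
  have hind (i j : ℕ) : IndepFun δ (fun ω => Tm i ω + Tp j ω) P :=
    h.indepFun_delta_times.comp (φ := id)
      (ψ := fun z : ℕ ⊕ ℕ → ℝ => z (Sum.inr i) + z (Sum.inl j)) measurable_id (by fun_prop)
  ext u hu
  have hprob (i j : ℕ) (D : Set ℝ) (hD : MeasurableSet D) :
      P (δ ⁻¹' D ∩ (fun ω => Tm i ω + Tp j ω) ⁻¹' u) =
        P (δ ⁻¹' D) * P.map (fun ω => Tm 0 ω + Tp 0 ω) u := by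
    rw [(hind i j).measure_inter_preimage_eq_mul D u hD hu, ← h.map_minus_add_plus i j,
      Measure.map_apply (hsum i j) hu]
  rw [Measure.map_apply hm hu]
  have hD : MeasurableSet (δ ⁻¹' {1}) := h.measurable_delta (measurableSet_singleton 1)
  rw [← measure_inter_add_sdiff _ hD, inter_comm, sdiff_eq, inter_comm _ (δ ⁻¹' {1})ᶜ,
    ← preimage_compl]
  have h1 : δ ⁻¹' {1} ∩ (fun ω => switchTime δ Tp Tm (n + 2) ω - switchTime δ Tp Tm n ω) ⁻¹' u =
      δ ⁻¹' {1} ∩ (fun ω => Tm i ω + Tp j ω) ⁻¹' u := by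
    ext ω
    refine and_congr_right fun hω => ?_
    have hω : δ ω = 1 := hω
    simp only [mem_preimage, hdiff, hcase, hω, if_true]
  have h2 : δ ⁻¹' {1}ᶜ ∩ (fun ω => switchTime δ Tp Tm (n + 2) ω - switchTime δ Tp Tm n ω) ⁻¹' u =
      δ ⁻¹' {1}ᶜ ∩ (fun ω => Tm i' ω + Tp j' ω) ⁻¹' u := by
    ext ω
    refine and_congr_right fun hω => ?_
    have hω : ¬ δ ω = 1 := hω
    simp only [mem_preimage, hdiff, hcase, hω, if_false]
  rw [h1, h2, hprob _ _ _ (measurableSet_singleton 1),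
    hprob _ _ _ (measurableSet_singleton 1).compl, ← add_mul, preimage_compl,
    measure_add_measure_compl hD, measure_univ, one_mul]

end IsSwitchData

/-! ### The normalised densities -/

lemma withDensity_const_mul_deriv {Ω : Type*} [MeasurableSpace Ω] (P : Measure Ω)
    (τ : ℕ → Ω → ℝ) {c : ℝ} (hc : 0 ≤ c) {f : ℝ → ℝ}
    (hf : ∀ t, f t = c * (-(1 / 2) * deriv (expectedSign P τ) t)) :
    (volume.restrict (Ioi 0)).withDensity (fun t => ENNReal.ofReal (f t)) =
      ENNReal.ofReal c • decreaseMeasure P τ := by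
  rw [decreaseMeasure, ← withDensity_smul _ (by fun_prop)]
  congr 1
  ext t
  rw [hf, ENNReal.ofReal_mul hc]
  rfl

namespace IsAlternatingRenewal

variable {Ω : Type*} [MeasurableSpace Ω] {P : Measure Ω} {τ : ℕ → Ω → ℝ} {a b : Measure ℝ}

lemma isProbabilityMeasure_smul_decreaseMeasure (h : IsAlternatingRenewal P τ a b)
    (hsign : ∀ t, 0 < t → DifferentiableAt ℝ (expectedSign P τ) t →
      0 ≤ -deriv (expectedSign P τ) t)
    (ha : Integrable (fun x => x) a) (hb : Integrable (fun x => x) b) {c : ℝ}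
    (hc : c = (∫ x, x ∂b) / ((∫ x, x ∂a) + ∫ x, x ∂b)) :
    IsProbabilityMeasure (ENNReal.ofReal (1 / c) • decreaseMeasure P τ) := by
  have := h.isProbabilityMeasure_even
  have := h.isProbabilityMeasure_odd
  have hma := integral_pos_of_ae_pos h.pos_even ha
  have hmb := integral_pos_of_ae_pos h.pos_odd hb
  have hc0 : 0 < c := by rw [hc]; positivity
  constructor
  rw [Measure.smul_apply, h.decreaseMeasure_univ hsign ha hb, ← hc, smul_eq_mul,
    ← ENNReal.ofReal_mul (by positivity), one_div_mul_cancel hc0.ne', ENNReal.ofReal_one]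

end IsAlternatingRenewal

/-- The transforms of the two geometric sums multiply to the product of the transforms `A` of `T⁺`
and `B` of `T⁻`: the first is `β / α * (A (1 - B) / (1 - A))`, the second has the roles exchanged. -/
lemma geometric_laplace_identity {α β A B : ℝ} (hα : 0 < α) (hβ : 0 < β) (hαβ : α + β = 1)
    (hA : 0 < A) (hA1 : A < 1) (hB : 0 < B) (hB1 : B < 1) {x y : ℝ}
    (hx : x = 1 / α * (A * (1 - B) / (1 - A * B)))
    (hy : y = 1 / β * (B * (1 - A) / (1 - B * A))) :
    β * x / (1 - (1 - β) * x) * (α * y / (1 - (1 - α) * y)) = B * A := by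
  have hAB : 0 < 1 - A * B := by nlinarith
  have hBA : 0 < 1 - B * A := by nlinarith
  have h1 : 1 - (1 - β) * x = (1 - A) / (1 - A * B) := by
    rw [show 1 - β = α by linarith, hx]
    field_simp
    ring
  have h2 : 1 - (1 - α) * y = (1 - B) / (1 - B * A) := by
    rw [show 1 - α = β by linarith, hy]
    field_simp
    ring
  have hA' : 1 - A ≠ 0 := by linarith
  have hB' : 1 - B ≠ 0 := by linarith
  rw [h1, h2, hx, hy]
  field_simp

lemma IsSwitchData.laplace_minus_add_plus {Ω : Type*} [MeasurableSpace Ω] {P : Measure Ω}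
    {δ : Ω → ℝ} {Tp Tm : ℕ → Ω → ℝ} (h : IsSwitchData P δ Tp Tm) (s : ℝ) :
    laplace (P.map fun ω => Tm 0 ω + Tp 0 ω) s =
      laplace (P.map (Tm 0)) s * laplace (P.map (Tp 0)) s := by
  have := laplace_map_finsetSum h.measurable_times h.indep_times {Sum.inr 0, Sum.inl 0} s
  simpa using this

end SwitchProcess

end

theorem theorem1 {Ω : Type*} [MeasurableSpace Ω] (P : Measure Ω) [IsProbabilityMeasure P]
    (δ : Ω → ℝ) (Tp Tm : ℕ → Ω → ℝ) (hD : SwitchProcess.IsSwitchData P δ Tp Tm)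
    (Ep Em : ℝ → ℝ)
    (hEp : Ep = SwitchProcess.expectedValue P δ Tp Tm 1)
    (hEm : Em = SwitchProcess.expectedValue P δ Tp Tm (-1))
    (hp : ∀ t : ℝ, 0 < t → DifferentiableAt ℝ Ep t → 0 ≤ -deriv Ep t)
    (hm : ∀ t : ℝ, 0 < t → DifferentiableAt ℝ Em t → 0 ≤ deriv Em t)
    (α β : ℝ)
    (hα : α = (∫ ω, Tm 0 ω ∂P) / ((∫ ω, Tp 0 ω ∂P) + ∫ ω, Tm 0 ω ∂P))
    (hβ : β = (∫ ω, Tp 0 ω ∂P) / ((∫ ω, Tp 0 ω ∂P) + ∫ ω, Tm 0 ω ∂P))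
    (fX fY : ℝ → ℝ)
    (hfX : fX = fun t => -(1 / (2 * α)) * deriv Ep t)
    (hfY : fY = fun t => 1 / (2 * β) * deriv Em t) :
    -- the derivatives exist almost everywhere on the positive half-line
    (∀ᵐ t ∂(volume.restrict (Set.Ioi (0 : ℝ))),
      DifferentiableAt ℝ Ep t ∧ DifferentiableAt ℝ Em t) ∧
    -- variables with the required joint law exist (so the two densities are probability densities)
    (∃ (Ω' : Type) (_ : MeasurableSpace Ω') (P' : Measure Ω') (να νβ : Ω' → ℕ)
      (X Y : ℕ → Ω' → ℝ), IsProbabilityMeasure P' ∧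
        SwitchProcess.IsGeometricSumData P' α β fX fY να νβ X Y) ∧
    -- and for all such variables the geometric sum has the law of the cycle length
    (∀ (Ω' : Type*) [MeasurableSpace Ω'] (P' : Measure Ω') [IsProbabilityMeasure P']
      (να νβ : Ω' → ℕ) (X Y : ℕ → Ω' → ℝ),
      SwitchProcess.IsGeometricSumData P' α β fX fY να νβ X Y →
        IdentDistrib (fun ω => Tm 0 ω + Tp 0 ω) (SwitchProcess.geometricSum να νβ X Y) P P' ∧
        ∀ n : ℕ, IdentDistrib
          (fun ω => SwitchProcess.switchTime δ Tp Tm (n + 2) ω -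
            SwitchProcess.switchTime δ Tp Tm n ω)
          (SwitchProcess.geometricSum να νβ X Y) P P') := by
  open SwitchProcess in
  have hP := hD.isAlternatingRenewal_plus
  have hM := hD.isAlternatingRenewal_minus
  rw [hD.expectedValue_one] at hEp
  rw [hD.expectedValue_neg_one] at hEm
  generalize ProbabilityTheory.cond P {ω | δ ω = 1} = Qp at hP hEp
  generalize ProbabilityTheory.cond P {ω | δ ω = -1} = Qm at hM hEm
  have hdm (t : ℝ) : deriv Em t = -deriv (expectedSign Qm (interlace Tm Tp)) t := by
    rw [hEm, deriv.fun_neg]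
  have hsp : ∀ t, 0 < t → DifferentiableAt ℝ (expectedSign Qp (interlace Tp Tm)) t →
      0 ≤ -deriv (expectedSign Qp (interlace Tp Tm)) t := hEp ▸ hp
  have hsm : ∀ t, 0 < t → DifferentiableAt ℝ (expectedSign Qm (interlace Tm Tp)) t →
      0 ≤ -deriv (expectedSign Qm (interlace Tm Tp)) t := fun t ht hd => by
    have := hm t ht (by rw [hEm]; exact hd.fun_neg)
    rwa [hdm] at this
  have := hP.isProbabilityMeasure_even
  have := hP.isProbabilityMeasure_odd
  -- the means of the laws of the switching times
  have hmean {T : Ω → ℝ} (hT : Measurable T) : ∫ x, x ∂(P.map T) = ∫ ω, T ω ∂P :=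
    integral_map hT.aemeasurable (f := fun x : ℝ => x) (by fun_prop)
  have hip : Integrable (fun x => x) (P.map (Tp 0)) :=
    (integrable_map_measure (by fun_prop) (hD.measurable_plus 0).aemeasurable).2 hD.integrable_plus
  have him : Integrable (fun x => x) (P.map (Tm 0)) :=
    (integrable_map_measure (by fun_prop) (hD.measurable_minus 0).aemeasurable).2
      hD.integrable_minus
  have hmp := integral_pos_of_ae_pos hD.pos_plus_law hip
  have hmm := integral_pos_of_ae_pos hD.pos_minus_law him
  rw [← hmean (hD.measurable_plus 0), ← hmean (hD.measurable_minus 0)] at hα hβ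
  have hα0 : 0 < α := by rw [hα]; positivity
  have hβ0 : 0 < β := by rw [hβ]; positivity
  have hαβ : α + β = 1 := by rw [hα, hβ]; field_simp; ring
  -- the two densities are those of the normalised measures of decrease
  have hκX := withDensity_const_mul_deriv Qp (interlace Tp Tm) (c := 1 / α) (f := fX)
    (by positivity) fun t => by rw [hfX, hEp]; field_simp
  have hκY := withDensity_const_mul_deriv Qm (interlace Tm Tp) (c := 1 / β) (f := fY)
    (by positivity) fun t => by simp only [hfY, hdm]; field_simp
  have hprobX := hP.isProbabilityMeasure_smul_decreaseMeasure hsp hip him hα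
  have hprobY := hM.isProbabilityMeasure_smul_decreaseMeasure hsm him hip
    (c := β) (by rw [hβ, add_comm])
  refine ⟨?_, exists_isGeometricSumData hα0 (by linarith) hβ0 (by linarith) (hκX ▸ hprobX)
    (hκY ▸ hprobY), fun Ω' _ P' _ να νβ X Y hG => ?_⟩
  · filter_upwards [hP.ae_hasDerivAt_expectedSign, hM.ae_hasDerivAt_expectedSign] with t h1 h2
    rw [hEp, hEm]
    exact ⟨h1.differentiableAt, h2.differentiableAt.fun_neg⟩
  have hmeas : Measurable fun ω => Tm 0 ω + Tp 0 ω :=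
    (hD.measurable_minus 0).add (hD.measurable_plus 0)
  have hlaw : P.map (fun ω => Tm 0 ω + Tp 0 ω) = P'.map (geometricSum να νβ X Y) := by
    have := Measure.isProbabilityMeasure_map (μ := P) hmeas.aemeasurable
    have := Measure.isProbabilityMeasure_map (μ := P') hG.measurable_geometricSum.aemeasurable
    refine eq_of_laplace_eq ?_ ?_ fun s hs => ?_
    · refine (ae_map_iff hmeas.aemeasurable measurableSet_Ici).2 ?_
      filter_upwards [hD.nonneg_plus, hD.nonneg_minus] with ω h1 h2 using add_nonneg h2 h1
    · exact (ae_map_iff hG.measurable_geometricSum.aemeasurable measurableSet_Ici).2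
        hG.ae_geometricSum_nonneg
    have hrange {a : Measure ℝ} [IsProbabilityMeasure a] (ha : ∀ᵐ x ∂a, 0 < x) :
        ∃ A : ℝ, 0 < A ∧ A < 1 ∧ laplace a s = ENNReal.ofReal A := by
      have h1 := laplace_lt_one ha hs
      have hne := (h1.trans ENNReal.one_lt_top).ne
      refine ⟨(laplace a s).toReal, ENNReal.toReal_pos (laplace_pos s).ne' hne, ?_,
        (ENNReal.ofReal_toReal hne).symm⟩
      rw [← ENNReal.toReal_one]
      exact (ENNReal.toReal_lt_toReal hne ENNReal.one_ne_top).2 h1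
    obtain ⟨A, hA, hA1, hAe⟩ := hrange hD.pos_plus_law
    obtain ⟨B, hB, hB1, hBe⟩ := hrange hD.pos_minus_law
    have hAB : 0 < 1 - A * B := by nlinarith
    have hBA : 0 < 1 - B * A := by nlinarith
    have hLX := hP.laplace_decreaseMeasure hsp hs
    have hLY := hM.laplace_decreaseMeasure hsm hs
    rw [hAe, hBe, ENNReal.toReal_ofReal hA.le, ENNReal.toReal_ofReal hB.le] at hLX hLY
    obtain ⟨x, hx⟩ : ∃ x, x = 1 / α * (A * (1 - B) / (1 - A * B)) := ⟨_, rfl⟩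
    obtain ⟨y, hy⟩ : ∃ y, y = 1 / β * (B * (1 - A) / (1 - B * A)) := ⟨_, rfl⟩
    have hA1' : 0 < 1 - A := by linarith
    have hB1' : 0 < 1 - B := by linarith
    have hx0 : 0 ≤ x := by rw [hx]; positivity
    have hy0 : 0 ≤ y := by rw [hy]; positivity
    have hX (k : ℕ) : laplace (P'.map (X k)) s = ENNReal.ofReal x := by
      rw [(hG.density_X k).2, hκX, laplace_smul, hLX, ← ENNReal.ofReal_mul (by positivity), hx]
    have hY (k : ℕ) : laplace (P'.map (Y k)) s = ENNReal.ofReal y := by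
      rw [(hG.density_Y k).2, hκY, laplace_smul, hLY, ← ENNReal.ofReal_mul (by positivity), hy]
    have hx1 : x ≤ 1 := ENNReal.ofReal_le_one.1 (hX 0 ▸ (hG.density_X 0).laplace_le_one hs.le)
    have hy1 : y ≤ 1 := ENNReal.ofReal_le_one.1 (hY 0 ▸ (hG.density_Y 0).laplace_le_one hs.le)
    rw [hG.laplace_geometricSum hα0 (by linarith) hβ0 (by linarith) hx0 hx1 hy0 hy1 hX hY,
      hD.laplace_minus_add_plus, hAe, hBe, ← ENNReal.ofReal_mul hB.le,
      ← geometric_laplace_identity hα0 hβ0 hαβ hA hA1 hB hB1 hx hy, ENNReal.ofReal_mul]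
    have : (1 - β) * x ≤ 1 := mul_le_one₀ (by linarith) hx0 hx1
    exact div_nonneg (by positivity) (by linarith)
  refine ⟨⟨hmeas.aemeasurable, hG.measurable_geometricSum.aemeasurable, hlaw⟩, fun n =>
    ⟨?_, hG.measurable_geometricSum.aemeasurable, (hD.map_switchTime_sub n).trans hlaw⟩⟩
  exact ((Finset.measurable_fun_sum _ fun i _ => hD.measurable_sojourn i).sub
    (Finset.measurable_fun_sum _ fun i _ => hD.measurable_sojourn i)).aemeasurable
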